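/- **Setting.** Let $H$ be a separable complex Hilbert space (inner products are linear in the second variable), $A$ a bounded operator on $H$ with $A^*A=AA^*=r I$ for a real $r>0$ (i.e. a nonzero multiple of a unitary operator), and $\phi\in H$ a vector of norm $1$ that is cyclic, i.e. $\{P(A,A^*)\phi : P\in\mathbb C[X,Y]\}$ is dense in $H$, where $X^iY^j(A,A^*)=A^i(A^*)^j$. For $N\in\mathbb N$ let $H_N$, $H_N^-$, $H_N^+$ be the linear spans of the vectors $A^i(A^*)^j\phi$ with $j\le N$ and, respectively, $i\le N$, $i<N$, $0<i\le N$. Let $W_N^\pm$ be the orthogonal complement of $H_N^\pm$ in $H_N$ and $U_N:W_N^-\to W_N^+$ a unitary operator, and let $A_N$ be the operator on $H_N$ that equals $A$ on $H_N^-$ and $\sqrt r\,U_N$ on $W_N^-$; it is normal. Let $D_N=\dim H_N$, and let $(u_N(n))_{n<D_N}$ be an orthonormal basis of $H_N$ consisting of eigenvectors of $A_N$, $A_Nu_N(n)=\lambda_N(n)u_N(n)$, with $\xi_N(n):=\langle u_N(n)|\phi\rangle$ real and $\ge 0$. Let $M$ be a natural number with $M>\|A\|$ and $M>\sqrt r$,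 and $S=\{\lambda\in\mathbb C: |\mathrm{Re}\,\lambda|\le M,\ |\mathrm{Im}\,\lambda|\le M\}$. Let $D$ be an ultrafilter on $\mathbb N$ that contains $\{N\ge 1: \sqrt N\in\mathbb N,\ m\mid\sqrt N\}$ for every $m\ge 1$. *Metric ultraproduct.* $H^m$ is the inner product space of the sequences $(v_N)$, $v_N\in H_N$, with $\|v_N\|$ bounded on a set in $D$, two sequences being identified if $\lim_D\|v_N-w_N\|=0$, with inner product $\lim_D\langle v_N|w_N\rangle$. Let $G^m:H\to H^m$ be the isometric embedding that sends $P(A,A^*)\phi$ (which lies in $H_N$ for all large $N$) to the class of the constant sequence $P(A,A^*)\phi$, and let $H^{Im}$ be its range. *Spectral measure.* For $X\subseteq\mathbb C$ let $\mu_N(X)=\sum_{\lambda_N(n)\in X}\xi_N(n)^2$ and $\mu^n(X)=\lim_D\mu_N(X)$. A real $t$ is nice if for all $\delta>0$ there is $\varepsilon>0$ such that $\mu^n(\{\lambda\in S:|\mathrm{Re}\,\lambda-t|<\varepsilon\})<\delta$ and $\mu^n(\{\lambda\in S:|\mathrm{Im}\,\lambda-t|<\varepsilon\})<\delta$. Let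 $NI$ be a countable dense subset of $[-M,M]$ consisting of nice reals and containing $\pm M$, and $Sq^*$ the family of the rectangles $\{\lambda\in S: a<\mathrm{Re}\,\lambda<b,\ c<\mathrm{Im}\,\lambda<d\}$ with $a,b,c,d\in NI$. For $Y\subseteq \mathrm{Int}(S)$ let $\mu^*(Y)=\inf\{\sum_i\mu^n(X_i): X_i\in Sq^*,\ Y\subseteq\bigcup_{i\in\mathbb N} X_i\}$, and let $\mu$ be the Borel measure $\mu(X)=\mu^*(X\cap \mathrm{Int}(S))$. *Spectral representation.* Write $\sigma(A)$ for the spectrum of $A$ and $f_P(\lambda)=P(\lambda,\overline\lambda)$ for $P\in\mathbb C[X,Y]$. Let $G^{r}:L_2(\sigma(A),\mu\restriction\sigma(A))\to H$ be the isometric isomorphism determined by $G^{r}(f_P)=P(A,A^*)\phi$. For a bounded operator $B$ on $H$ let $B_D=(G^{r})^{-1}BG^{r}$. **Lemma.** Let $B$ be a bounded operator on $H$ and $K:\sigma(A)^2\to\mathbb C$ a continuous function such that for all $P\in\mathbb C[X,Y]$ the class $B_D(f_P)$ has a continuous representative $g$ with $$g(y)=\int_{\sigma(A)}K(x,y)f_P(x)\,d\mu(x)\qquad\text{for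 all } y\in\sigma(A).$$ Then $K$ extends to a continuous function on $S^2$, and for every such extension, again denoted $K$, the linear operators $$B_N\Big(\sum_{k<D_N}a_ku_N(k)\Big)=\sum_{n<D_N}\sum_{k<D_N}\xi_N(k)\,\xi_N(n)\,a_k\,K(\lambda_N(k),\lambda_N(n))\,u_N(n)$$ on the spaces $H_N$ have the following properties. 1. There is a natural number $K_D$ such that $\|B_N(v)\|<K_D\|v\|$ for all $N$ and all nonzero $v\in H_N$. In particular the metric ultraproduct $B^m$ of the operators $B_N$, sending the class of $(v_N)$ to the class of $(B_N(v_N))$, is a well-defined bounded operator on $H^m$. 2. The restriction of $B^m$ to $H^{Im}$ equals $G^mB(G^m)^{-1}$. -/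

import Mathlib

open Filter Topology MeasureTheory
open scoped ENNReal InnerProductSpace

noncomputable section

namespace FiniteApproximation

/-! ### Ultraproducts of a sequence of inner product spaces -/

section Ultraproduct

variable (D : Ultrafilter ℕ) (E : ℕ → Type*) [∀ N, NormedAddCommGroup (E N)]
  [∀ N, InnerProductSpace ℂ (E N)]

/-- The sequences `(v_N)` whose norm in the ultraproduct along `D` is finite. -/
def finiteSeqSubmodule : Submodule ℂ (∀ N, E N) where
  carrier := {v | ∃ C : ℝ, ∀ᶠ N in (D : Filter ℕ), ‖v N‖ ≤ C}
  zero_mem' := ⟨0, by simp⟩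
  add_mem' := by
    rintro v w ⟨C, hC⟩ ⟨C', hC'⟩
    refine ⟨C + C', ?_⟩
    filter_upwards [hC, hC'] with N h h'
    exact (norm_add_le _ _).trans (add_le_add h h')
  smul_mem' := by
    rintro c v ⟨C, hC⟩
    refine ⟨‖c‖ * C, ?_⟩
    filter_upwards [hC] with N h
    rw [Pi.smul_apply, norm_smul]
    exact mul_le_mul_of_nonneg_left h (norm_nonneg _)

/-- The type of sequences of finite norm. It is a type of its own so that it does not carry the
product topology. -/
def FiniteSeq : Type _ := ↥(finiteSeqSubmodule D E)

instance : AddCommGroup (FiniteSeq D E) := inferInstanceAs (AddCommGroup (finiteSeqSubmodule D E))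

instance : Module ℂ (FiniteSeq D E) := inferInstanceAs (Module ℂ (finiteSeqSubmodule D E))

variable {D E}

/-- The `N`-th term of a sequence. -/
def FiniteSeq.term (v : FiniteSeq D E) (N : ℕ) : E N := v.1 N

theorem FiniteSeq.term_add (v w : FiniteSeq D E) (N : ℕ) :
    (v + w).term N = v.term N + w.term N := rfl

theorem FiniteSeq.term_smul (c : ℂ) (v : FiniteSeq D E) (N : ℕ) :
    (c • v).term N = c • v.term N := rfl

theorem FiniteSeq.term_sub (v w : FiniteSeq D E) (N : ℕ) :
    (v - w).term N = v.term N - w.term N := rfl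

/-- A sequence in a proper metric space that is bounded along an ultrafilter has an ultralimit. -/
theorem exists_ultralimit {F : Type*} [NormedAddCommGroup F] [ProperSpace F] (D : Ultrafilter ℕ)
    (f : ℕ → F) (C : ℝ) (h : ∀ᶠ N in (D : Filter ℕ), ‖f N‖ ≤ C) :
    ∃ x, Tendsto f (D : Filter ℕ) (𝓝 x) := by
  have hc : IsCompact (Metric.closedBall (0 : F) C) := isCompact_closedBall 0 C
  obtain ⟨x, -, hx⟩ := hc.ultrafilter_le_nhds (D.map f) (by
    rw [Filter.le_principal_iff]
    refine Filter.mem_map.2 (h.mono fun N hN => ?_)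
    simpa using hN)
  exact ⟨x, hx⟩

/-- The inner product of two sequences of finite norm: the ultralimit of the inner products. -/
def ultraInner (v w : FiniteSeq D E) : ℂ :=
  limUnder (D : Filter ℕ) fun N => inner ℂ (v.term N) (w.term N)

theorem tendsto_ultraInner (v w : FiniteSeq D E) :
    Tendsto (fun N => inner ℂ (v.term N) (w.term N)) (D : Filter ℕ) (𝓝 (ultraInner v w)) := by
  obtain ⟨C, hC⟩ := v.2
  obtain ⟨C', hC'⟩ := w.2
  refine tendsto_nhds_limUnder (exists_ultralimit D _ (C * C') ?_)
  filter_upwards [hC, hC'] with N h h'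
  exact (norm_inner_le_norm _ _).trans
    (mul_le_mul h h' (norm_nonneg _) ((norm_nonneg _).trans h))

instance : PreInnerProductSpace.Core ℂ (FiniteSeq D E) where
  inner := ultraInner
  conj_inner_symm v w := by
    refine tendsto_nhds_unique ?_ (tendsto_ultraInner v w)
    have h := (Complex.continuous_conj.tendsto _).comp (tendsto_ultraInner w v)
    refine h.congr fun N => ?_
    simp
  re_inner_nonneg v := by
    have h := (Complex.continuous_re.tendsto _).comp (tendsto_ultraInner v v)
    refine ge_of_tendsto' h fun N => ?_
    exact inner_self_nonneg (𝕜 := ℂ)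
  add_left v w x := by
    refine tendsto_nhds_unique (tendsto_ultraInner _ _) ?_
    refine ((tendsto_ultraInner v x).add (tendsto_ultraInner w x)).congr fun N => ?_
    rw [FiniteSeq.term_add, inner_add_left]
  smul_left v w c := by
    refine tendsto_nhds_unique (tendsto_ultraInner _ _) ?_
    refine ((tendsto_ultraInner v w).const_mul _).congr fun N => ?_
    rw [FiniteSeq.term_smul, inner_smul_left]

instance : SeminormedAddCommGroup (FiniteSeq D E) :=
  InnerProductSpace.Core.toSeminormedAddCommGroup (𝕜 := ℂ)

instance : InnerProductSpace ℂ (FiniteSeq D E) := InnerProductSpace.ofCore _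

theorem tendsto_norm (v : FiniteSeq D E) :
    Tendsto (fun N => ‖v.term N‖) (D : Filter ℕ) (𝓝 ‖v‖) := by
  have h := (Real.continuous_sqrt.tendsto _).comp
    ((Complex.continuous_re.tendsto _).comp (tendsto_ultraInner v v))
  refine h.congr fun N => ?_
  simp only [Function.comp]
  exact (norm_eq_sqrt_re_inner (𝕜 := ℂ) (v.term N)).symm

variable (D E) in
/-- The metric ultraproduct `H^m` of the spaces `E N`: the sequences of finite norm, two of them
being identified when the norm of their difference is infinitesimal. -/
abbrev MetricUltraproduct : Type _ := SeparationQuotient (FiniteSeq D E)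

/-- The class in the metric ultraproduct of a sequence of finite norm. -/
def ultraClass (v : ∀ N, E N) (hv : v ∈ finiteSeqSubmodule D E) : MetricUltraproduct D E :=
  SeparationQuotient.mk (⟨v, hv⟩ : FiniteSeq D E)

theorem ultraClass_congr {v w : ∀ N, E N} (hv : v ∈ finiteSeqSubmodule D E)
    (hw : w ∈ finiteSeqSubmodule D E) (h : ∀ᶠ N in (D : Filter ℕ), v N = w N) :
    ultraClass v hv = ultraClass w hw := by
  let v' : FiniteSeq D E := ⟨v, hv⟩
  let w' : FiniteSeq D E := ⟨w, hw⟩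
  change (SeparationQuotient.mk v' : MetricUltraproduct D E) = SeparationQuotient.mk w'
  refine SeparationQuotient.mk_eq_mk.2 (Metric.inseparable_iff.2 ?_)
  rw [dist_eq_norm]
  refine tendsto_nhds_unique (tendsto_norm _) (tendsto_const_nhds.congr' ?_)
  filter_upwards [h] with N hN
  rw [FiniteSeq.term_sub, show v'.term N = w'.term N from hN, sub_self, norm_zero]

/-- The operators `T N` are uniformly bounded: there is a natural number `K`, independent of `N`,
with `‖T_N v‖ < K ‖v‖` for all nonzero `v` in the `N`-th space. -/
def UniformlyBounded (T : ∀ N, E N →ₗ[ℂ] E N) : Prop :=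
  ∃ K : ℕ, ∀ N, ∀ v : E N, v ≠ 0 → ‖T N v‖ < K * ‖v‖

theorem UniformlyBounded.exists_bound {T : ∀ N, E N →ₗ[ℂ] E N} (hT : UniformlyBounded T) :
    ∃ K : ℝ, ∀ N, ∀ v : E N, ‖T N v‖ ≤ K * ‖v‖ := by
  obtain ⟨K, hK⟩ := hT
  refine ⟨K, fun N v => ?_⟩
  rcases eq_or_ne v 0 with rfl | hv
  · simp
  · exact (hK N v hv).le

theorem UniformlyBounded.mem {T : ∀ N, E N →ₗ[ℂ] E N} (hT : UniformlyBounded T)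
    {v : ∀ N, E N} (hv : v ∈ finiteSeqSubmodule D E) :
    (fun N => T N (v N)) ∈ finiteSeqSubmodule D E := by
  obtain ⟨K, hK⟩ := hT.exists_bound
  obtain ⟨C, hC⟩ := hv
  refine ⟨|K| * C, ?_⟩
  filter_upwards [hC] with N h
  exact ((hK N _).trans (mul_le_mul_of_nonneg_right (le_abs_self K) (norm_nonneg _))).trans
    (mul_le_mul_of_nonneg_left h (abs_nonneg K))

/-- Uniformly bounded operators, applied term by term to sequences of finite norm. -/
def ultraOperatorSeq (D : Ultrafilter ℕ) (T : ∀ N, E N →ₗ[ℂ] E N) (hT : UniformlyBounded T) :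
    FiniteSeq D E →L[ℂ] FiniteSeq D E :=
  LinearMap.mkContinuousOfExistsBound
    { toFun := fun v => ⟨fun N => T N (v.1 N), hT.mem v.2⟩
      map_add' := fun v w => Subtype.ext (funext fun N => map_add (T N) (v.1 N) (w.1 N))
      map_smul' := fun c v => Subtype.ext (funext fun N => map_smul (T N) c (v.1 N)) }
    (by
      obtain ⟨K, hK⟩ := hT.exists_bound
      exact ⟨K, fun v => le_of_tendsto_of_tendsto' (tendsto_norm _)
        ((tendsto_norm v).const_mul K) fun N => hK N _⟩)

/-- The metric ultraproduct of the uniformly bounded operators `T N`: the operator on `H^m` that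
sends the class of `(v_N)` to the class of `(T_N v_N)`. -/
def ultraOperator (D : Ultrafilter ℕ) (T : ∀ N, E N →ₗ[ℂ] E N) (hT : UniformlyBounded T) :
    MetricUltraproduct D E →L[ℂ] MetricUltraproduct D E :=
  SeparationQuotient.liftCLM ((SeparationQuotient.mkCLM ℂ (FiniteSeq D E)).comp
    (ultraOperatorSeq D T hT))
    fun _ _ h => SeparationQuotient.mk_eq_mk.2 (h.map (ultraOperatorSeq D T hT).continuous)

theorem ultraOperator_ultraClass (T : ∀ N, E N →ₗ[ℂ] E N) (hT : UniformlyBounded T)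
    (v : ∀ N, E N) (hv : v ∈ finiteSeqSubmodule D E) :
    ultraOperator D T hT (ultraClass v hv) = ultraClass (fun N => T N (v N)) (hT.mem hv) := rfl

end Ultraproduct

/-! ### The operator `A` and the spaces `H_N` -/

variable {H : Type*} [NormedAddCommGroup H] [InnerProductSpace ℂ H] [CompleteSpace H]

/-- `A ^ i (A^*) ^ j`. -/
def monomialOp (A : H →L[ℂ] H) (i j : ℕ) : H →L[ℂ] H := A ^ i * (ContinuousLinearMap.adjoint A) ^ j

/-- The operator `P(A, A^*)` for a polynomial `P` in two variables: the linear map in `P` that sends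
the monomial `X ^ i Y ^ j` to `A ^ i (A^*) ^ j`. -/
def polyOp (A : H →L[ℂ] H) : MvPolynomial (Fin 2) ℂ →ₗ[ℂ] (H →L[ℂ] H) :=
  (MvPolynomial.basisMonomials (Fin 2) ℂ).constr ℂ fun m => monomialOp A (m 0) (m 1)

/-- The linear map `P ↦ P(A, A^*) φ`. -/
def polyVec (A : H →L[ℂ] H) (φ : H) : MvPolynomial (Fin 2) ℂ →ₗ[ℂ] H :=
  (ContinuousLinearMap.apply ℂ H φ).toLinearMap ∘ₗ polyOp A

variable (H) in
/-- A bounded operator `A` with `A^* A = A A^* = r I`, `r > 0` (that is, a nonzero multiple of a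
unitary operator), together with a cyclic vector `φ` of norm one. -/
structure CyclicOperator where
  A : H →L[ℂ] H
  r : ℝ
  r_pos : 0 < r
  adjoint_mul_self : ContinuousLinearMap.adjoint A * A = (r : ℂ) • (1 : H →L[ℂ] H)
  self_mul_adjoint : A * ContinuousLinearMap.adjoint A = (r : ℂ) • (1 : H →L[ℂ] H)
  φ : H
  norm_φ : ‖φ‖ = 1
  cyclic : DenseRange (polyVec A φ)

namespace CyclicOperator

variable (𝒞 : CyclicOperator H)

/-- The span of the vectors `A ^ i (A^*) ^ j φ`, `i ∈ I`, `j ∈ J`. -/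
def span (I J : Set ℕ) : Submodule ℂ H :=
  Submodule.span ℂ (Set.image2 (fun i j => monomialOp 𝒞.A i j 𝒞.φ) I J)

/-- The space `H_N`. -/
def HN (N : ℕ) : Submodule ℂ H := 𝒞.span (Set.Iic N) (Set.Iic N)

/-- The space `H_N^-`. -/
def HNminus (N : ℕ) : Submodule ℂ H := 𝒞.span (Set.Iio N) (Set.Iic N)

/-- The space `H_N^+`. -/
def HNplus (N : ℕ) : Submodule ℂ H := 𝒞.span (Set.Ioc 0 N) (Set.Iic N)

theorem finiteDimensional_span {I J : Set ℕ} (hI : I.Finite) (hJ : J.Finite) :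
    FiniteDimensional ℂ (𝒞.span I J) :=
  FiniteDimensional.span_of_finite ℂ (hI.image2 _ hJ)

instance (N : ℕ) : FiniteDimensional ℂ (𝒞.HN N) :=
  𝒞.finiteDimensional_span (Set.finite_Iic N) (Set.finite_Iic N)

instance (N : ℕ) : FiniteDimensional ℂ (𝒞.HNminus N) :=
  𝒞.finiteDimensional_span (Set.finite_Iio N) (Set.finite_Iic N)

instance (N : ℕ) : FiniteDimensional ℂ (𝒞.HNplus N) :=
  𝒞.finiteDimensional_span (Set.finite_Ioc 0 N) (Set.finite_Iic N)

/-- The orthogonal complement `W^-` of `H_N^-` in `H_N`. -/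
def Wminus (N : ℕ) : Submodule ℂ H := (𝒞.HNminus N)ᗮ ⊓ 𝒞.HN N

/-- The orthogonal complement `W^+` of `H_N^+` in `H_N`. -/
def Wplus (N : ℕ) : Submodule ℂ H := (𝒞.HNplus N)ᗮ ⊓ 𝒞.HN N

instance (N : ℕ) : FiniteDimensional ℂ (𝒞.Wminus N) := Submodule.finiteDimensional_inf_right _ _

theorem A_mem_HN {N : ℕ} {v : H} (hv : v ∈ 𝒞.HNminus N) : 𝒞.A v ∈ 𝒞.HN N := by
  have h : 𝒞.HNminus N ≤ (𝒞.HN N).comap 𝒞.A.toLinearMap := by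
    refine Submodule.span_le.2 ?_
    rintro _ ⟨i, hi, j, hj, rfl⟩
    refine Submodule.subset_span ⟨i + 1, Nat.succ_le_of_lt hi, j, hj, ?_⟩
    simp [monomialOp, pow_succ']
  exact h hv

/-- The operator `A_N` on `H_N` determined by a unitary operator `U` from `W^-` onto `W^+`:
it is `A` on `H_N^-` and `√r U` on `W^-`. -/
def AN (N : ℕ) (U : 𝒞.Wminus N ≃ₗᵢ[ℂ] 𝒞.Wplus N) : 𝒞.HN N →ₗ[ℂ] 𝒞.HN N where
  toFun v :=
    ⟨𝒞.A ((𝒞.HNminus N).orthogonalProjectionOnto (v : H)) +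
      (√𝒞.r : ℂ) • (U ((𝒞.Wminus N).orthogonalProjectionOnto (v : H)) : H),
      add_mem (𝒞.A_mem_HN (Submodule.coe_mem _))
        (Submodule.smul_mem _ _ (Submodule.coe_mem (U _)).2)⟩
  map_add' v w := by
    ext
    simp only [Submodule.coe_add, map_add, smul_add]
    abel
  map_smul' c v := by
    ext
    simp only [Submodule.coe_smul, map_smul, smul_add, RingHom.id_apply, smul_comm c]

theorem φ_mem_HN (N : ℕ) : 𝒞.φ ∈ 𝒞.HN N :=
  Submodule.subset_span ⟨0, Nat.zero_le N, 0, Nat.zero_le N, by simp [monomialOp]⟩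

theorem HN_mono : Monotone 𝒞.HN := fun _ _ h =>
  Submodule.span_mono (Set.image2_subset (Set.Iic_subset_Iic.2 h) (Set.Iic_subset_Iic.2 h))

theorem polyVec_mem_iSup (P : MvPolynomial (Fin 2) ℂ) : polyVec 𝒞.A 𝒞.φ P ∈ ⨆ N, 𝒞.HN N := by
  have h : ⊤ ≤ (⨆ N, 𝒞.HN N).comap (polyVec 𝒞.A 𝒞.φ) := by
    rw [← (MvPolynomial.basisMonomials (Fin 2) ℂ).span_eq, Submodule.span_le]
    rintro _ ⟨m, rfl⟩
    refine Submodule.mem_iSup_of_mem (max (m 0) (m 1)) (Submodule.subset_span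
      ⟨m 0, Set.mem_Iic.2 (le_max_left _ _), m 1, Set.mem_Iic.2 (le_max_right _ _), ?_⟩)
    simp only [polyVec, polyOp, LinearMap.comp_apply, Module.Basis.constr_basis]
    rfl
  exact h trivial

theorem top_le_closure : ⊤ ≤ (⨆ N, 𝒞.HN N).topologicalClosure := by
  intro x _
  refine closure_mono ?_ (𝒞.cyclic x)
  rintro _ ⟨P, rfl⟩
  exact 𝒞.polyVec_mem_iSup P

/-- The class in the metric ultraproduct of the projections of `ψ` to the spaces `H_N`. -/
def GmLinear (D : Ultrafilter ℕ) : H →ₗ[ℂ] MetricUltraproduct D (fun N => 𝒞.HN N) where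
  toFun ψ := ultraClass (fun N => (𝒞.HN N).orthogonalProjectionOnto ψ)
    ⟨‖ψ‖, Eventually.of_forall fun N => Submodule.norm_orthogonalProjectionOnto_apply_le _ _⟩
  map_add' v w := by
    refine (congrArg SeparationQuotient.mk ?_).trans (SeparationQuotient.mk_add _ _)
    exact Subtype.ext (funext fun N => map_add _ _ _)
  map_smul' c v := by
    refine (congrArg SeparationQuotient.mk ?_).trans (SeparationQuotient.mk_smul _ _)
    exact Subtype.ext (funext fun N => map_smul _ _ _)

/-- The isometric embedding `G^m` of `H` into the metric ultraproduct of the spaces `H_N`, for an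
ultrafilter `D` that contains no finite set. It is determined by the property that it sends
`P(A, A^*) φ`, which lies in `H_N` for all large `N`, to the class of the sequence with this
constant value (see `Gm_polyVec`). -/
def Gm (D : Ultrafilter ℕ) (hD : (D : Filter ℕ) ≤ atTop) :
    H →ₗᵢ[ℂ] MetricUltraproduct D (fun N => 𝒞.HN N) where
  toLinearMap := 𝒞.GmLinear D
  norm_map' ψ := by
    refine tendsto_nhds_unique (tendsto_norm (D := D) (E := fun N => 𝒞.HN N)
      ⟨fun N => (𝒞.HN N).orthogonalProjectionOnto ψ, _⟩) ?_
    have h := (Submodule.starProjection_tendsto_self 𝒞.HN 𝒞.HN_mono ψ 𝒞.top_le_closure).norm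
    exact h.mono_left hD

theorem Gm_polyVec (D : Ultrafilter ℕ) (hD : (D : Filter ℕ) ≤ atTop)
    (P : MvPolynomial (Fin 2) ℂ) (v : ∀ N, 𝒞.HN N)
    (hv : v ∈ finiteSeqSubmodule D (fun N => 𝒞.HN N))
    (h : ∀ᶠ N in (D : Filter ℕ), (v N : H) = polyVec 𝒞.A 𝒞.φ P) :
    𝒞.Gm D hD (polyVec 𝒞.A 𝒞.φ P) = ultraClass v hv := by
  refine ultraClass_congr _ _ ?_
  filter_upwards [h] with N hN
  rw [← hN, Submodule.orthogonalProjectionOnto_mem_subspace_eq_self]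

end CyclicOperator

/-! ### The finite dimensional approximations and the spectral measure -/

/-- The choices made in the construction of the finite dimensional approximations. -/
structure Approximation (𝒞 : CyclicOperator H) where
  /-- the unitary operators from `W^-` onto `W^+` used to define `A_N` -/
  U : ∀ N, 𝒞.Wminus N ≃ₗᵢ[ℂ] 𝒞.Wplus N
  /-- the orthonormal basis `u_N(n)`, `n < D_N`, of `H_N` -/
  u : ∀ N, OrthonormalBasis (Fin (Module.finrank ℂ (𝒞.HN N))) ℂ (𝒞.HN N)
  /-- the eigenvalues `λ_N(n)` of `A_N` -/
  lam : ∀ N, Fin (Module.finrank ℂ (𝒞.HN N)) → ℂ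
  AN_u : ∀ N n, 𝒞.AN N (U N) (u N n) = lam N n • u N n
  /-- the coefficients `ξ_N(n)` of `φ` in the basis `u_N(n)` -/
  xi : ∀ N, Fin (Module.finrank ℂ (𝒞.HN N)) → ℝ
  xi_nonneg : ∀ N n, 0 ≤ xi N n
  inner_u_φ : ∀ N n, inner ℂ (u N n : H) 𝒞.φ = (xi N n : ℂ)
  /-- half of the side length of the square `S` -/
  M : ℕ
  norm_lt_M : ‖𝒞.A‖ < M
  sqrt_lt_M : √𝒞.r < M
  /-- the ultrafilter -/
  D : Ultrafilter ℕ
  mem_D : ∀ m : ℕ, m ≠ 0 → {N : ℕ | N ≠ 0 ∧ ∃ k : ℕ, N = k ^ 2 ∧ m ∣ k} ∈ D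

namespace Approximation

variable {𝒞 : CyclicOperator H} (𝒜 : Approximation 𝒞)

theorem D_le_atTop : (𝒜.D : Filter ℕ) ≤ atTop := by
  refine atTop_basis.ge_iff.2 fun m _ => ?_
  refine mem_of_superset (𝒜.mem_D (m + 1) m.succ_ne_zero) ?_
  rintro _ ⟨hN, k, rfl, hk⟩
  have hk0 : 0 < k := Nat.pos_of_ne_zero (by rintro rfl; simp at hN)
  have h1 := Nat.le_of_dvd hk0 hk
  exact Set.mem_Ici.2 (by nlinarith)

/-- The isometric embedding `G^m` of `H` into `H^m`. -/
def Gm : H →ₗᵢ[ℂ] MetricUltraproduct 𝒜.D (fun N => 𝒞.HN N) := 𝒞.Gm 𝒜.D 𝒜.D_le_atTop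

/-- The image `H^Im` of `H` in the metric ultraproduct. -/
def HIm : Submodule ℂ (MetricUltraproduct 𝒜.D (fun N => 𝒞.HN N)) :=
  LinearMap.range 𝒜.Gm.toLinearMap

/-- `G^m` as an isometric isomorphism from `H` onto `H^Im`. -/
def GmEquiv : H ≃ₗᵢ[ℂ] 𝒜.HIm := 𝒜.Gm.equivRange

theorem coe_GmEquiv (ψ : H) : (𝒜.GmEquiv ψ : MetricUltraproduct 𝒜.D (fun N => 𝒞.HN N)) = 𝒜.Gm ψ :=
  rfl

/-- The measure `μ_N(X)`: the sum of all `ξ_N(n) ^ 2` with `λ_N(n) ∈ X`. -/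
def muN (N : ℕ) (X : Set ℂ) : ℝ := ∑ n, X.indicator (fun _ => 𝒜.xi N n ^ 2) (𝒜.lam N n)

/-- The naive measure `μ^n(X)`: the ultralimit of `μ_N(X)`. -/
def muNaive (X : Set ℂ) : ℝ := limUnder (𝒜.D : Filter ℕ) fun N => 𝒜.muN N X

theorem sum_xi_sq (N : ℕ) : ∑ n, 𝒜.xi N n ^ 2 = 1 := by
  have h := (𝒜.u N).sum_sq_norm_inner_right (⟨𝒞.φ, 𝒞.φ_mem_HN N⟩ : 𝒞.HN N)
  have h2 : ‖(⟨𝒞.φ, 𝒞.φ_mem_HN N⟩ : 𝒞.HN N)‖ = 1 := 𝒞.norm_φ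
  rw [h2, one_pow] at h
  rw [← h]
  refine Finset.sum_congr rfl fun n _ => ?_
  rw [Submodule.coe_inner, 𝒜.inner_u_φ, Complex.norm_real, Real.norm_eq_abs, sq_abs]

theorem muN_nonneg (N : ℕ) (X : Set ℂ) : 0 ≤ 𝒜.muN N X :=
  Finset.sum_nonneg fun _ _ => Set.indicator_nonneg (fun _ _ => sq_nonneg _) _

theorem muN_mono (N : ℕ) {X Y : Set ℂ} (h : X ⊆ Y) : 𝒜.muN N X ≤ 𝒜.muN N Y :=
  Finset.sum_le_sum fun _ _ => Set.indicator_le_indicator_of_subset h (fun _ => sq_nonneg _) _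

theorem muN_univ (N : ℕ) : 𝒜.muN N Set.univ = 1 := by
  simp [muN, 𝒜.sum_xi_sq]

theorem muN_union (N : ℕ) {X Y : Set ℂ} (h : Disjoint X Y) :
    𝒜.muN N (X ∪ Y) = 𝒜.muN N X + 𝒜.muN N Y := by
  simp only [muN, ← Finset.sum_add_distrib]
  refine Finset.sum_congr rfl fun n _ => ?_
  rw [Set.indicator_union_of_disjoint h]

theorem tendsto_muN (X : Set ℂ) :
    Tendsto (fun N => 𝒜.muN N X) (𝒜.D : Filter ℕ) (𝓝 (𝒜.muNaive X)) := by
  refine tendsto_nhds_limUnder (exists_ultralimit 𝒜.D _ 1 (Eventually.of_forall fun N => ?_))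
  rw [Real.norm_eq_abs, abs_of_nonneg (𝒜.muN_nonneg N X), ← 𝒜.muN_univ N]
  exact 𝒜.muN_mono N (Set.subset_univ X)

theorem muNaive_nonneg (X : Set ℂ) : 0 ≤ 𝒜.muNaive X :=
  ge_of_tendsto' (𝒜.tendsto_muN X) fun N => 𝒜.muN_nonneg N X

theorem muNaive_empty : 𝒜.muNaive ∅ = 0 :=
  tendsto_nhds_unique (𝒜.tendsto_muN ∅) (tendsto_const_nhds.congr fun N => by simp [muN])

theorem muNaive_mono {X Y : Set ℂ} (h : X ⊆ Y) : 𝒜.muNaive X ≤ 𝒜.muNaive Y :=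
  le_of_tendsto_of_tendsto' (𝒜.tendsto_muN X) (𝒜.tendsto_muN Y) fun N => 𝒜.muN_mono N h

theorem muNaive_union {X Y : Set ℂ} (h : Disjoint X Y) :
    𝒜.muNaive (X ∪ Y) = 𝒜.muNaive X + 𝒜.muNaive Y :=
  tendsto_nhds_unique (𝒜.tendsto_muN _)
    (((𝒜.tendsto_muN X).add (𝒜.tendsto_muN Y)).congr fun N => (𝒜.muN_union N h).symm)

/-- The square `S`. -/
def S : Set ℂ := {z | -(𝒜.M : ℝ) ≤ z.re ∧ z.re ≤ 𝒜.M ∧ -(𝒜.M : ℝ) ≤ z.im ∧ z.im ≤ 𝒜.M}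

/-- The interior of the square `S`. -/
def intS : Set ℂ := {z | -(𝒜.M : ℝ) < z.re ∧ z.re < 𝒜.M ∧ -(𝒜.M : ℝ) < z.im ∧ z.im < 𝒜.M}

/-- A real `t` is nice if the naive measures of thin strips around the vertical and the horizontal
line through `t` are arbitrarily small. -/
def IsNice (t : ℝ) : Prop :=
  ∀ δ > 0, ∃ ε > 0, 𝒜.muNaive {z | z ∈ 𝒜.S ∧ |z.re - t| < ε} < δ ∧
    𝒜.muNaive {z | z ∈ 𝒜.S ∧ |z.im - t| < ε} < δ

/-- A countable dense set `NI` of nice reals in `[-M, M]` that contains `-M` and `M`. -/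
structure NiceSet where
  NI : Set ℝ
  subset : NI ⊆ Set.Icc (-(𝒜.M : ℝ)) 𝒜.M
  countable : NI.Countable
  dense : Set.Icc (-(𝒜.M : ℝ)) 𝒜.M ⊆ closure NI
  nice : ∀ t ∈ NI, 𝒜.IsNice t
  neg_mem : -(𝒜.M : ℝ) ∈ NI
  mem : (𝒜.M : ℝ) ∈ NI

end Approximation

namespace Approximation.NiceSet

variable {𝒞 : CyclicOperator H} {𝒜 : Approximation 𝒞} (𝒩 : 𝒜.NiceSet)

/-- The family `Sq^*` of the open rectangles with nice coordinates. -/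
def SqStar : Set (Set ℂ) :=
  {Y | ∃ a ∈ 𝒩.NI, ∃ b ∈ 𝒩.NI, ∃ c ∈ 𝒩.NI, ∃ d ∈ 𝒩.NI,
    Y = {z | z ∈ 𝒜.S ∧ a < z.re ∧ z.re < b ∧ c < z.im ∧ z.im < d}}

theorem empty_mem_SqStar : ∅ ∈ 𝒩.SqStar :=
  ⟨_, 𝒩.mem, _, 𝒩.mem, _, 𝒩.mem, _, 𝒩.mem, by
    ext z
    simp only [Set.mem_empty_iff_false, Set.mem_ofPred_eq, false_iff]
    rintro ⟨-, h, h', -⟩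
    exact lt_asymm h h'⟩

theorem intS_mem_SqStar : 𝒜.intS ∈ 𝒩.SqStar :=
  ⟨_, 𝒩.neg_mem, _, 𝒩.mem, _, 𝒩.neg_mem, _, 𝒩.mem, by
    ext z
    simp only [Approximation.intS, Approximation.S, Set.mem_ofPred_eq]
    constructor
    · rintro ⟨h1, h2, h3, h4⟩
      exact ⟨⟨h1.le, h2.le, h3.le, h4.le⟩, h1, h2, h3, h4⟩
    · rintro ⟨-, h⟩
      exact h⟩

/-- The outer measure `μ^*`: the infimum of the sums `∑ μ^n(X_i)` over the countable covers by
sets `X_i` in `Sq^*`. -/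
def muStar : OuterMeasure ℂ :=
  inducedOuterMeasure (P := fun Y => Y ∈ 𝒩.SqStar) (fun Y _ => ENNReal.ofReal (𝒜.muNaive Y))
    𝒩.empty_mem_SqStar (by simp [𝒜.muNaive_empty])

theorem muStar_le {Y : Set ℂ} (hY : Y ∈ 𝒩.SqStar) :
    𝒩.muStar Y ≤ ENNReal.ofReal (𝒜.muNaive Y) :=
  le_inducedOuterMeasure.1 le_rfl Y hY

/-- To test that a set is measurable it suffices to cut the sets in `Sq^*`. -/
theorem isCaratheodory_of_SqStar {T : Set ℂ}
    (h : ∀ X ∈ 𝒩.SqStar, 𝒩.muStar (X ∩ T) + 𝒩.muStar (X \ T) ≤ ENNReal.ofReal (𝒜.muNaive X)) :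
    𝒩.muStar.IsCaratheodory T := by
  rw [OuterMeasure.isCaratheodory_iff_le']
  intro t
  conv_rhs => rw [muStar, inducedOuterMeasure, OuterMeasure.ofFunction_apply]
  refine le_iInf₂ fun f hf => ?_
  by_cases hS : ∀ i, f i ∈ 𝒩.SqStar
  · have h1 : 𝒩.muStar (t ∩ T) ≤ ∑' i, 𝒩.muStar (f i ∩ T) := by
      refine le_trans (measure_mono ?_) (measure_iUnion_le _)
      rw [← Set.iUnion_inter]
      exact Set.inter_subset_inter_left _ hf
    have h2 : 𝒩.muStar (t \ T) ≤ ∑' i, 𝒩.muStar (f i \ T) := by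
      refine le_trans (measure_mono ?_) (measure_iUnion_le _)
      rw [← Set.iUnion_sdiff]
      exact Set.sdiff_subset_sdiff_left hf
    refine (add_le_add h1 h2).trans ?_
    rw [← ENNReal.tsum_add]
    refine ENNReal.tsum_le_tsum fun i => ?_
    rw [extend_eq _ (hS i)]
    exact h _ (hS i)
  · push Not at hS
    obtain ⟨i, hi⟩ := hS
    have : extend (P := fun Y => Y ∈ 𝒩.SqStar)
        (fun Y _ => ENNReal.ofReal (𝒜.muNaive Y)) (f i) = ⊤ := iInf_neg hi
    rw [ENNReal.tsum_eq_top_of_eq_top ⟨i, this⟩]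
    exact le_top

theorem exists_mem_between {x y : ℝ} (hx : -(𝒜.M : ℝ) ≤ x) (hy : y ≤ 𝒜.M) (h : x < y) :
    ∃ b ∈ 𝒩.NI, x < b ∧ b < y := by
  have hz : (x + y) / 2 ∈ Set.Icc (-(𝒜.M : ℝ)) 𝒜.M := ⟨by linarith, by linarith⟩
  obtain ⟨b, hb, hbN⟩ := mem_closure_iff.1 (𝒩.dense hz) (Set.Ioo x y) isOpen_Ioo
    ⟨by linarith, by linarith⟩
  exact ⟨b, hbN, hb.1, hb.2⟩

/-- The lines with nice coordinates are null sets (inside the interior of `S`). -/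
theorem muStar_line {t : ℝ} (ht : t ∈ 𝒩.NI) {X : Set ℂ} (hX : X ⊆ 𝒜.intS)
    (h : (∀ z ∈ X, z.re = t) ∨ ∀ z ∈ X, z.im = t) : 𝒩.muStar X = 0 := by
  rcases X.eq_empty_or_nonempty with rfl | ⟨z₀, hz₀⟩
  · simp
  have hM : -(𝒜.M : ℝ) < t ∧ t < 𝒜.M := by
    obtain ⟨h1, h2, h3, h4⟩ := hX hz₀
    rcases h with h | h
    · rw [← h z₀ hz₀]; exact ⟨h1, h2⟩
    · rw [← h z₀ hz₀]; exact ⟨h3, h4⟩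
  refine le_antisymm (ENNReal.le_of_forall_pos_le_add fun δ hδ _ => ?_) zero_le
  obtain ⟨ε, hε, hre, him⟩ := 𝒩.nice t ht δ hδ
  obtain ⟨a, ha, ha1, ha2⟩ := 𝒩.exists_mem_between (x := max (-(𝒜.M : ℝ)) (t - ε)) (y := t)
    (le_max_left _ _) hM.2.le (max_lt hM.1 (by linarith))
  obtain ⟨b, hb, hb1, hb2⟩ := 𝒩.exists_mem_between (x := t) (y := min (𝒜.M : ℝ) (t + ε))
    hM.1.le (min_le_left _ _) (lt_min hM.2 (by linarith))
  have ha3 := (max_lt_iff.1 ha1).2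
  have hb3 := (lt_min_iff.1 hb2).2
  rw [zero_add]
  rcases h with h | h
  · refine (measure_mono (t := {z | z ∈ 𝒜.S ∧ a < z.re ∧ z.re < b ∧ -(𝒜.M : ℝ) < z.im ∧
      z.im < 𝒜.M}) fun z hz => ?_).trans ((𝒩.muStar_le
        ⟨a, ha, b, hb, _, 𝒩.neg_mem, _, 𝒩.mem, rfl⟩).trans ?_)
    · obtain ⟨h1, h2, h3, h4⟩ := hX hz
      exact ⟨⟨h1.le, h2.le, h3.le, h4.le⟩, by rw [h z hz]; exact ha2, by rw [h z hz]; exact hb1,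
        h3, h4⟩
    · rw [← ENNReal.ofReal_coe_nnreal]
      refine ENNReal.ofReal_le_ofReal ((𝒜.muNaive_mono ?_).trans hre.le)
      rintro z ⟨hz, h1, h2, -⟩
      exact ⟨hz, abs_lt.2 ⟨by linarith, by linarith⟩⟩
  · refine (measure_mono (t := {z | z ∈ 𝒜.S ∧ -(𝒜.M : ℝ) < z.re ∧ z.re < 𝒜.M ∧ a < z.im ∧
      z.im < b}) fun z hz => ?_).trans ((𝒩.muStar_le
        ⟨_, 𝒩.neg_mem, _, 𝒩.mem, a, ha, b, hb, rfl⟩).trans ?_)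
    · obtain ⟨h1, h2, h3, h4⟩ := hX hz
      exact ⟨⟨h1.le, h2.le, h3.le, h4.le⟩, h1, h2, by rw [h z hz]; exact ha2,
        by rw [h z hz]; exact hb1⟩
    · rw [← ENNReal.ofReal_coe_nnreal]
      refine ENNReal.ofReal_le_ofReal ((𝒜.muNaive_mono ?_).trans him.le)
      rintro z ⟨hz, -, -, h1, h2⟩
      exact ⟨hz, abs_lt.2 ⟨by linarith, by linarith⟩⟩

theorem min_mem {a b : ℝ} (ha : a ∈ 𝒩.NI) (hb : b ∈ 𝒩.NI) : min a b ∈ 𝒩.NI := by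
  rcases min_choice a b with h | h <;> rw [h] <;> assumption

theorem max_mem {a b : ℝ} (ha : a ∈ 𝒩.NI) (hb : b ∈ 𝒩.NI) : max a b ∈ 𝒩.NI := by
  rcases max_choice a b with h | h <;> rw [h] <;> assumption

theorem subset_intS {X : Set ℂ} (hX : X ∈ 𝒩.SqStar) : X ⊆ 𝒜.intS := by
  obtain ⟨a, ha, b, hb, c, hc, d, hd, rfl⟩ := hX
  rintro z ⟨-, h1, h2, h3, h4⟩
  exact ⟨(𝒩.subset ha).1.trans_lt h1, h2.trans_le (𝒩.subset hb).2, (𝒩.subset hc).1.trans_lt h3,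
    h4.trans_le (𝒩.subset hd).2⟩

/-- A half plane bounded by a nice line is measurable, given that it cuts the sets in `Sq^*` into
two sets in `Sq^*` and a part of a line. -/
theorem isCaratheodory_half (p : ℂ → ℝ) {t : ℝ} (ht : t ∈ 𝒩.NI)
    (hp : (∀ z, p z = z.re) ∨ ∀ z, p z = z.im) :
    𝒩.muStar.IsCaratheodory {z | p z < t} := by
  refine 𝒩.isCaratheodory_of_SqStar fun X hX => ?_
  have h1 : X ∩ {z | p z < t} ∈ 𝒩.SqStar := by
    obtain ⟨a, ha, b, hb, c, hc, d, hd, rfl⟩ := hX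
    rcases hp with hp | hp
    · refine ⟨a, ha, min b t, 𝒩.min_mem hb ht, c, hc, d, hd, ?_⟩
      ext z; simp only [Set.mem_inter_iff, Set.mem_ofPred_eq, hp, lt_min_iff]; tauto
    · refine ⟨a, ha, b, hb, c, hc, min d t, 𝒩.min_mem hd ht, ?_⟩
      ext z; simp only [Set.mem_inter_iff, Set.mem_ofPred_eq, hp, lt_min_iff]; tauto
  have h2 : X ∩ {z | t < p z} ∈ 𝒩.SqStar := by
    obtain ⟨a, ha, b, hb, c, hc, d, hd, rfl⟩ := hX
    rcases hp with hp | hp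
    · refine ⟨max a t, 𝒩.max_mem ha ht, b, hb, c, hc, d, hd, ?_⟩
      ext z; simp only [Set.mem_inter_iff, Set.mem_ofPred_eq, hp, max_lt_iff]; tauto
    · refine ⟨a, ha, b, hb, max c t, 𝒩.max_mem hc ht, d, hd, ?_⟩
      ext z; simp only [Set.mem_inter_iff, Set.mem_ofPred_eq, hp, max_lt_iff]; tauto
  have h3 : 𝒩.muStar (X ∩ {z | p z = t}) = 0 := by
    refine 𝒩.muStar_line ht (Set.inter_subset_left.trans (𝒩.subset_intS hX)) ?_
    rcases hp with hp | hp
    · exact Or.inl fun z hz => (hp z).symm.trans hz.2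
    · exact Or.inr fun z hz => (hp z).symm.trans hz.2
  have h4 : X \ {z | p z < t} ⊆ X ∩ {z | t < p z} ∪ X ∩ {z | p z = t} := by
    rintro z ⟨hz, hz'⟩
    rcases lt_or_eq_of_le (not_lt.1 (show ¬ p z < t from hz')) with h | h
    · exact Or.inl ⟨hz, h⟩
    · exact Or.inr ⟨hz, h.symm⟩
  have h5 : 𝒩.muStar (X \ {z | p z < t}) ≤ 𝒩.muStar (X ∩ {z | t < p z}) := by
    refine ((measure_mono h4).trans (measure_union_le _ _)).trans ?_
    rw [h3, add_zero]
  refine (add_le_add (𝒩.muStar_le h1) (h5.trans (𝒩.muStar_le h2))).trans ?_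
  rw [← ENNReal.ofReal_add (𝒜.muNaive_nonneg _) (𝒜.muNaive_nonneg _), ← 𝒜.muNaive_union]
  · exact ENNReal.ofReal_le_ofReal (𝒜.muNaive_mono
      (Set.union_subset Set.inter_subset_left Set.inter_subset_left))
  · refine Set.disjoint_left.2 ?_
    rintro z ⟨-, hz⟩ ⟨-, hz'⟩
    exact lt_asymm (show p z < t from hz) hz'

theorem measurable_coord (p : ℂ → ℝ) (hp : (∀ z, p z = z.re) ∨ ∀ z, p z = z.im) :
    Measurable[𝒩.muStar.caratheodory] p := by
  refine @measurable_of_Iio ℝ ℂ _ _ _ 𝒩.muStar.caratheodory _ _ _ p fun t => ?_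
  change 𝒩.muStar.IsCaratheodory {z | p z < t}
  have hS : ∀ X ∈ 𝒩.SqStar, ∀ z ∈ X, -(𝒜.M : ℝ) < p z ∧ p z < 𝒜.M := by
    intro X hX z hz
    obtain ⟨h1, h2, h3, h4⟩ := 𝒩.subset_intS hX hz
    rcases hp with hp | hp
    · rw [hp]; exact ⟨h1, h2⟩
    · rw [hp]; exact ⟨h3, h4⟩
  -- inside the interior of `S` the half plane is a countable union of nice ones
  have hU : MeasurableSet[𝒩.muStar.caratheodory] (⋃ b ∈ {b ∈ 𝒩.NI | b ≤ t}, {z | p z < b}) :=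
    MeasurableSet.biUnion (m := 𝒩.muStar.caratheodory)
      (𝒩.countable.mono (Set.sep_subset _ _)) fun b hb => 𝒩.isCaratheodory_half p hb.1 hp
  refine 𝒩.isCaratheodory_of_SqStar fun X hX => ?_
  have hXU : X ∩ {z | p z < t} = X ∩ ⋃ b ∈ {b ∈ 𝒩.NI | b ≤ t}, {z | p z < b} := by
    ext z
    simp only [Set.mem_inter_iff, Set.mem_ofPred_eq, Set.mem_iUnion, exists_prop]
    refine and_congr_right fun hz => ⟨fun h => ?_, fun ⟨b, hb, h⟩ => h.trans_le hb.2⟩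
    obtain ⟨h1, h2⟩ := hS X hX z hz
    obtain ⟨b, hb, hb1, hb2⟩ := 𝒩.exists_mem_between (x := p z) (y := min t 𝒜.M)
      h1.le (min_le_right _ _) (lt_min h h2)
    exact ⟨b, ⟨hb, (hb2.trans_le (min_le_left _ _)).le⟩, hb1⟩
  have hXU' : X \ {z | p z < t} = X \ ⋃ b ∈ {b ∈ 𝒩.NI | b ≤ t}, {z | p z < b} := by
    rw [← Set.sdiff_self_inter, hXU, Set.sdiff_self_inter]
  rw [hXU, hXU', ← hU X]
  exact 𝒩.muStar_le hX

/-- The Borel sets are measurable for `μ^*`. -/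
theorem borel_le_caratheodory : (inferInstance : MeasurableSpace ℂ) ≤ 𝒩.muStar.caratheodory := by
  have h1 := 𝒩.measurable_coord Complex.re (Or.inl fun _ => rfl)
  have h2 := 𝒩.measurable_coord Complex.im (Or.inr fun _ => rfl)
  have h3 : Measurable[𝒩.muStar.caratheodory] fun z : ℂ => (z.re, z.im) := h1.prodMk h2
  have h4 : Measurable[𝒩.muStar.caratheodory] fun z : ℂ =>
      Complex.measurableEquivRealProd.symm (z.re, z.im) :=
    Complex.measurableEquivRealProd.symm.measurable.comp h3
  intro s hs
  exact h4 hs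

/-- The spectral measure `μ`, as a Borel measure on `ℂ`: `μ(X) = μ^*(X ∩ Int S)`. -/
def mu : Measure ℂ := (𝒩.muStar.toMeasure 𝒩.borel_le_caratheodory).restrict 𝒜.intS

theorem mu_univ_le : 𝒩.mu Set.univ ≤ 1 := by
  rw [mu, Measure.restrict_apply_univ]
  have hm : MeasurableSet 𝒜.intS := by
    have : 𝒜.intS = Set.Ioo (-(𝒜.M : ℝ)) 𝒜.M ×ℂ Set.Ioo (-(𝒜.M : ℝ)) 𝒜.M := by
      ext z; simp [Approximation.intS, Complex.mem_reProdIm, and_assoc]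
    rw [this]
    exact (isOpen_Ioo.reProdIm isOpen_Ioo).measurableSet
  rw [toMeasure_apply _ _ hm]
  refine (𝒩.muStar_le 𝒩.intS_mem_SqStar).trans ?_
  rw [← ENNReal.ofReal_one]
  refine ENNReal.ofReal_le_ofReal (le_of_tendsto' (𝒜.tendsto_muN _) fun N => ?_)
  rw [← 𝒜.muN_univ N]
  exact 𝒜.muN_mono N (Set.subset_univ _)

instance : IsFiniteMeasure 𝒩.mu := ⟨𝒩.mu_univ_le.trans_lt ENNReal.one_lt_top⟩

/-- The measure `μ` restricted to the spectrum of `A`. -/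
def muSpec : Measure (spectrum ℂ 𝒞.A) := 𝒩.mu.comap Subtype.val

instance : IsFiniteMeasure 𝒩.muSpec := inferInstanceAs (IsFiniteMeasure (𝒩.mu.comap _))

/-- The space `L_2(σ(A), μ ↾ σ(A))`. -/
abbrev L2Spec : Type _ := Lp ℂ 2 𝒩.muSpec

/-- The class in `L_2(σ(A), μ ↾ σ(A))` of a continuous function on `σ(A)`. -/
def toL2 : C(spectrum ℂ 𝒞.A, ℂ) →L[ℂ] 𝒩.L2Spec := ContinuousMap.toLp 2 𝒩.muSpec ℂ

end Approximation.NiceSet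

/-- The function `f_P(λ) = P(λ, conj λ)` on the spectrum of `A`. -/
def polyFun (𝒞 : CyclicOperator H) : MvPolynomial (Fin 2) ℂ →ₐ[ℂ] C(spectrum ℂ 𝒞.A, ℂ) :=
  MvPolynomial.aeval ![⟨Subtype.val, continuous_subtype_val⟩,
    star ⟨Subtype.val, continuous_subtype_val⟩]

theorem polyFun_apply (𝒞 : CyclicOperator H) (P : MvPolynomial (Fin 2) ℂ)
    (z : spectrum ℂ 𝒞.A) :
    polyFun 𝒞 P z = MvPolynomial.eval ![(z : ℂ), starRingEnd ℂ (z : ℂ)] P := by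
  induction P using MvPolynomial.induction_on with
  | C a => simp [polyFun]
  | add p q hp hq => rw [map_add, ContinuousMap.add_apply, hp, hq, map_add]
  | mul_X p i hp =>
    rw [map_mul, ContinuousMap.mul_apply, hp, map_mul]
    congr 1
    fin_cases i <;> simp [polyFun]

namespace Approximation.NiceSet

variable {𝒞 : CyclicOperator H} {𝒜 : Approximation 𝒞} (𝒩 : 𝒜.NiceSet)

/-- The linear map `P ↦ [f_P]`. -/
def polyL2 : MvPolynomial (Fin 2) ℂ →ₗ[ℂ] 𝒩.L2Spec :=
  𝒩.toL2.toLinearMap ∘ₗ (polyFun 𝒞).toLinearMap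

/-- The isometric isomorphism `G^{-r}` from `H` onto `L_2(σ(A), μ ↾ σ(A))`: the continuous
extension of `P(A, A^*) φ ↦ [f_P]`. (The norms of `P(A, A^*) φ` and of `[f_P]` agree, and these
vectors are dense in the two spaces, so that the extension exists and is unique.) -/
def GrInv : H →L[ℂ] 𝒩.L2Spec := 𝒩.polyL2.extendOfNorm (polyVec 𝒞.A 𝒞.φ)

/-- The inverse `G^r` of `G^{-r}`: the continuous extension of `[f_P] ↦ P(A, A^*) φ`. -/
def Gr : 𝒩.L2Spec →L[ℂ] H := (polyVec 𝒞.A 𝒞.φ).extendOfNorm 𝒩.polyL2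

/-- The operator `B` in the spectral representation of `A`: `B_D = G^{-r} B G^r`. -/
def BD (B : H →L[ℂ] H) : 𝒩.L2Spec →L[ℂ] 𝒩.L2Spec := 𝒩.GrInv ∘L B ∘L 𝒩.Gr

/-- `B` has the continuous kernel `K` on `σ(A) ^ 2` in the spectral representation of `A`: for all
polynomials `P`, the class `B_D(f_P)` has a continuous representative `g` such that
`g(y) = ∫ K(x, y) f_P(x) dμ(x)` for all `y` in `σ(A)`. -/
def HasKernel (B : H →L[ℂ] H) (K : C(spectrum ℂ 𝒞.A × spectrum ℂ 𝒞.A, ℂ)) : Prop :=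
  ∀ P : MvPolynomial (Fin 2) ℂ, ∃ g : C(spectrum ℂ 𝒞.A, ℂ),
    𝒩.toL2 g = 𝒩.BD B (𝒩.toL2 (polyFun 𝒞 P)) ∧
      ∀ y, g y = ∫ x, K (x, y) * polyFun 𝒞 P x ∂𝒩.muSpec

end Approximation.NiceSet

namespace Approximation

variable {𝒞 : CyclicOperator H} (𝒜 : Approximation 𝒞)

/-- `K'` is a continuation of `K` to a continuous function on `S ^ 2`. -/
def IsContinuation (K : C(spectrum ℂ 𝒞.A × spectrum ℂ 𝒞.A, ℂ)) (K' : ℂ × ℂ → ℂ) : Prop :=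
  ContinuousOn K' (𝒜.S ×ˢ 𝒜.S) ∧ ∀ x y : spectrum ℂ 𝒞.A, K' (x, y) = K (x, y)

/-- The operator `B_N` on `H_N` built from the values of the kernel at the eigenvalues of `A_N`:
it sends `∑ a_k u_N(k)` to `∑_n ∑_k ξ_N(k) ξ_N(n) a_k K(λ_N(k), λ_N(n)) u_N(n)`. -/
def kernelOp (K' : ℂ × ℂ → ℂ) (N : ℕ) : 𝒞.HN N →ₗ[ℂ] 𝒞.HN N where
  toFun v := ∑ n, ∑ k, ((𝒜.xi N k : ℂ) * 𝒜.xi N n * (𝒜.u N).repr v k *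
    K' (𝒜.lam N k, 𝒜.lam N n)) • 𝒜.u N n
  map_add' v w := by
    simp only [← Finset.sum_add_distrib, ← add_smul]
    refine Finset.sum_congr rfl fun n _ => Finset.sum_congr rfl fun k _ => ?_
    rw [map_add, PiLp.add_apply]
    ring_nf
  map_smul' c v := by
    simp only [Finset.smul_sum, smul_smul, RingHom.id_apply]
    refine Finset.sum_congr rfl fun n _ => Finset.sum_congr rfl fun k _ => ?_
    rw [map_smul, PiLp.smul_apply, smul_eq_mul]
    ring_nf

/-- The metric ultraproduct `B^m` of the uniformly bounded operators `T N`,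
restricted to `H^Im`, equals `G^m B (G^m)^{-1}`. -/
def RestrictsTo (T : ∀ N, 𝒞.HN N →ₗ[ℂ] 𝒞.HN N) (hT : UniformlyBounded T) (B : H →L[ℂ] H) :
    Prop :=
  ∀ x : 𝒜.HIm, ultraOperator 𝒜.D T hT x = 𝒜.Gm (B (𝒜.GmEquiv.symm x))

end Approximation

end FiniteApproximation

end

/-! `A` scales norms by `√r` and maps `H_N^-` into `H_N^+`, while `U_N` maps `W_N^-` onto `W_N^+`.
So `A_N` is `√r` times an isometry and all its eigenvalues lie on the circle of radius `√r`, inside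
`S`. For `i, j ≤ N` the vector `A^i (A^*)^j φ` has the coefficient `λ^i (conj λ)^j ξ` at an
eigenvector (`inner_u_monomial`). Hence, for fixed `P` and all large `N`, the vector `P(A, A^*) φ`
has the coefficients `f_P(λ) ξ` (`eventually_polyVec`), and the integral of `f_P` for `μ_N` is
exactly `⟨φ, P(A, A^*) φ⟩`.

By Stone–Weierstrass the `μ_N` converge weakly to the spectral measure `ν` of `A` and `φ`
(`tendsto_intN`). Weak convergence bounds `ν` by the naive measure on open sets, so `ν ≤ μ`. As `ν`
has mass one and `μ` has mass at most one, they agree (`muSpec_eq`).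

The matrix of `B_N` is `ξ_N(k) ξ_N(n) K(λ_N(k), λ_N(n))` with `ξ_N` a unit vector, so a bound for
`|K|` on `S^2` bounds all `B_N` (`norm_kernelOp_le`). The coefficient of `B_N P(A, A^*) φ` at
`u_N(n)` is `ξ_N(n)` times a `μ_N`-integral, which is close, uniformly in `n`, to `h(λ_N(n))` with
`h(y) = ∫ K(x, y) f_P(x) dμ(x)`. Choose `Q` with `f_Q` close to `h` on `S`. Then `Q(A, A^*) φ` is
close to `B_N P(A, A^*) φ` by comparing coefficients, and close to `B P(A, A^*) φ` because `h`
represents `B_D(f_P)` on `σ(A)` (`tendsto_kernelOp`). Eigenvalues of `A_N` may lie off `σ(A)`, so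
`h` and `f_Q` have to be compared on all of `S`. Density and continuity give the general case. -/

namespace FiniteApproximation

variable {H : Type*} [NormedAddCommGroup H] [InnerProductSpace ℂ H] [CompleteSpace H]

/-! ### Polynomials in `z` and `conj z` -/

/-- The value `P(z, conj z)`. -/
noncomputable def polyEval (P : MvPolynomial (Fin 2) ℂ) (z : ℂ) : ℂ :=
  MvPolynomial.eval ![z, starRingEnd ℂ z] P

theorem polyEval_monomial (m : Fin 2 →₀ ℕ) (c z : ℂ) :
    polyEval (MvPolynomial.monomial m c) z = c * (z ^ m 0 * (starRingEnd ℂ z) ^ m 1) := by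
  simp [polyEval, MvPolynomial.eval_monomial, Finsupp.prod_fintype, Fin.prod_univ_two]

theorem polyEval_add (P Q : MvPolynomial (Fin 2) ℂ) (z : ℂ) :
    polyEval (P + Q) z = polyEval P z + polyEval Q z := map_add _ _ _

theorem continuous_polyEval (P : MvPolynomial (Fin 2) ℂ) : Continuous (polyEval P) := by
  have h : Continuous fun z : ℂ => ![z, starRingEnd ℂ z] := by
    refine continuous_pi fun i => ?_
    fin_cases i
    · exact continuous_id
    · exact Complex.continuous_conj
  exact (MvPolynomial.continuous_eval P).comp h

/-- **Stone–Weierstrass** for polynomials in `z` and `conj z` on a compact subset of `ℂ`. -/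
theorem exists_polyEval_near {s : Set ℂ} (hs : IsCompact s) (f : C(s, ℂ)) {ε : ℝ} (hε : 0 < ε) :
    ∃ P : MvPolynomial (Fin 2) ℂ, ∀ z : s, ‖polyEval P z - f z‖ < ε := by
  have : CompactSpace s := isCompact_iff_compactSpace.1 hs
  have key (g : C(s, ℂ)) (hg : g ∈ StarAlgebra.adjoin ℂ {ContinuousMap.restrict s (.id ℂ)}) :
      ∃ P : MvPolynomial (Fin 2) ℂ, ∀ z : s, polyEval P z = g z := by
    induction hg using StarAlgebra.adjoin_induction with
    | mem x hx =>
      obtain rfl := hx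
      exact ⟨MvPolynomial.X 0, fun z => by simp [polyEval]⟩
    | algebraMap r => exact ⟨MvPolynomial.C r, fun z => by simp [polyEval]⟩
    | add x y _ _ hx hy =>
      obtain ⟨P, hP⟩ := hx
      obtain ⟨Q, hQ⟩ := hy
      exact ⟨P + Q, fun z => by simp [polyEval_add, hP, hQ]⟩
    | mul x y _ _ hx hy =>
      obtain ⟨P, hP⟩ := hx
      obtain ⟨Q, hQ⟩ := hy
      exact ⟨P * Q, fun z => by simp [← hP, ← hQ, polyEval]⟩
    | star x _ hx =>
      obtain ⟨P, hP⟩ := hx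
      -- The conjugate of `P(z, conj z)` is obtained by conjugating the coefficients and exchanging
      -- the two variables.
      refine ⟨MvPolynomial.rename ![1, 0] (MvPolynomial.map (starRingEnd ℂ) P), fun z => ?_⟩
      rw [ContinuousMap.star_apply, ← hP, polyEval, polyEval, MvPolynomial.eval_rename,
        MvPolynomial.eval_map, ← starRingEnd_apply, ← MvPolynomial.eval₂_id,
        MvPolynomial.eval₂_comp_left, RingHom.comp_id]
      congr 1
      ext i
      fin_cases i <;> simp
  have hf : f ∈ StarAlgebra.elemental ℂ (ContinuousMap.restrict s (.id ℂ)) := by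
    rw [ContinuousMap.elemental_id_eq_top]; trivial
  obtain ⟨g, hg, hfg⟩ := Metric.mem_closure_iff.1 hf ε hε
  obtain ⟨P, hP⟩ := key g hg
  refine ⟨P, fun z => ?_⟩
  rw [hP, ← dist_eq_norm]
  exact (ContinuousMap.dist_apply_le_dist z).trans_lt (by rwa [dist_comm])

/-! ### `A` and `A_N` as multiples of isometries -/

namespace CyclicOperator

variable (𝒞 : CyclicOperator H)

theorem polyVec_monomial (m : Fin 2 →₀ ℕ) (c : ℂ) :
    polyVec 𝒞.A 𝒞.φ (MvPolynomial.monomial m c) = c • monomialOp 𝒞.A (m 0) (m 1) 𝒞.φ := by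
  have : MvPolynomial.monomial m c = c • MvPolynomial.basisMonomials (Fin 2) ℂ m := by
    simp [MvPolynomial.smul_monomial]
  rw [this, map_smul]
  simp only [polyVec, polyOp, LinearMap.comp_apply, Module.Basis.constr_basis]
  rfl

theorem norm_A_apply (v : H) : ‖𝒞.A v‖ ^ 2 = 𝒞.r * ‖v‖ ^ 2 := by
  have h := ContinuousLinearMap.apply_norm_sq_eq_inner_adjoint_left 𝒞.A v
  have h2 : (ContinuousLinearMap.adjoint 𝒞.A ∘L 𝒞.A) v = (𝒞.r : ℂ) • v := by
    have := congrArg (fun T : H →L[ℂ] H => T v) 𝒞.adjoint_mul_self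
    simpa using this
  rw [h, h2, inner_smul_left, inner_self_eq_norm_sq_to_K]
  simp [← Complex.ofReal_pow]

/-- Landing in `H_N^+`, not only in `H_N`, is what makes `A w` orthogonal to the values of `U_N` in
`W_N^+`. -/
theorem A_mem_HNplus {N : ℕ} {v : H} (hv : v ∈ 𝒞.HNminus N) : 𝒞.A v ∈ 𝒞.HNplus N := by
  have h : 𝒞.HNminus N ≤ (𝒞.HNplus N).comap 𝒞.A.toLinearMap := by
    refine Submodule.span_le.2 ?_
    rintro _ ⟨i, hi, j, hj, rfl⟩
    refine Submodule.subset_span ⟨i + 1, ⟨Nat.succ_pos i, hi⟩, j, hj, ?_⟩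
    simp [monomialOp, pow_succ']
  exact h hv

theorem HNminus_le_HN (N : ℕ) : 𝒞.HNminus N ≤ 𝒞.HN N :=
  Submodule.span_mono (Set.image2_subset (fun _ h => (Set.mem_Iio.1 h).le) subset_rfl)

theorem proj_Wminus_eq_zero {N : ℕ} {v : H} (hv : v ∈ 𝒞.HNminus N) :
    (𝒞.Wminus N).orthogonalProjectionOnto v = 0 := by
  rw [Submodule.orthogonalProjectionOnto_eq_zero_iff, Submodule.mem_orthogonal]
  intro u hu
  exact (Submodule.mem_orthogonal' _ _).1 hu.1 v hv

theorem AN_apply_of_mem_HNminus {N : ℕ} (U : 𝒞.Wminus N ≃ₗᵢ[ℂ] 𝒞.Wplus N) (v : 𝒞.HN N)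
    (hv : (v : H) ∈ 𝒞.HNminus N) : (𝒞.AN N U v : H) = 𝒞.A v := by
  have h2 := Submodule.orthogonalProjectionOnto_mem_subspace_eq_self (⟨v, hv⟩ : 𝒞.HNminus N)
  simp only [AN, LinearMap.coe_mk, AddHom.coe_mk, 𝒞.proj_Wminus_eq_zero hv, map_zero]
  rw [h2]
  simp

/-- Split `v = w + x` along `H_N^-` and `W_N^-`. The images `A w` and `√r U x` lie in `H_N^+` and
`W_N^+`, so Pythagoras applies before and after. -/
theorem norm_AN_apply {N : ℕ} (U : 𝒞.Wminus N ≃ₗᵢ[ℂ] 𝒞.Wplus N) (v : 𝒞.HN N) :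
    ‖𝒞.AN N U v‖ ^ 2 = 𝒞.r * ‖v‖ ^ 2 := by
  set w : 𝒞.HNminus N := (𝒞.HNminus N).orthogonalProjectionOnto (v : H) with hw
  have hx : (v : H) - w ∈ 𝒞.Wminus N :=
    ⟨Submodule.sub_starProjection_mem_orthogonal _, sub_mem v.2 (𝒞.HNminus_le_HN N w.2)⟩
  set x : 𝒞.Wminus N := ⟨(v : H) - w, hx⟩ with hxdef
  have hv : (v : H) = w + x := by simp [hxdef]
  have hproj : (𝒞.Wminus N).orthogonalProjectionOnto (v : H) = x := by
    rw [hv, map_add, 𝒞.proj_Wminus_eq_zero w.2, zero_add,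
      Submodule.orthogonalProjectionOnto_mem_subspace_eq_self]
  have hAN : (𝒞.AN N U v : H) = 𝒞.A w + (√𝒞.r : ℂ) • (U x : H) := by
    simp only [AN, LinearMap.coe_mk, AddHom.coe_mk, hproj, ← hw]
  have h1 : inner ℂ (w : H) (x : H) = 0 := (Submodule.mem_orthogonal _ _).1 x.2.1 _ w.2
  have h2 : inner ℂ (𝒞.A w) ((√𝒞.r : ℂ) • (U x : H)) = 0 := by
    rw [inner_smul_right, (Submodule.mem_orthogonal _ _).1 (U x).2.1 _ (𝒞.A_mem_HNplus w.2),
      mul_zero]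
  have hU : ‖(U x : H)‖ = ‖(x : H)‖ := U.norm_map x
  have e1 := norm_add_sq_eq_norm_sq_add_norm_sq_of_inner_eq_zero _ _ h1
  have e2 := norm_add_sq_eq_norm_sq_add_norm_sq_of_inner_eq_zero _ _ h2
  simp only [← pow_two] at e1 e2
  rw [← Submodule.norm_coe (𝒞.AN N U v), ← Submodule.norm_coe v, hAN, hv, e1, e2,
    𝒞.norm_A_apply, norm_smul, hU, mul_pow, Complex.norm_real, Real.norm_eq_abs, sq_abs, Real.sq_sqrt 𝒞.r_pos.le]
  ring

theorem monomial_mem_HN {N i j : ℕ} (hi : i ≤ N) (hj : j ≤ N) :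
    monomialOp 𝒞.A i j 𝒞.φ ∈ 𝒞.HN N :=
  Submodule.subset_span ⟨i, hi, j, hj, rfl⟩

theorem monomial_mem_HNminus {N i j : ℕ} (hi : i < N) (hj : j ≤ N) :
    monomialOp 𝒞.A i j 𝒞.φ ∈ 𝒞.HNminus N :=
  Submodule.subset_span ⟨i, hi, j, hj, rfl⟩

theorem A_monomial (i j : ℕ) (v : H) : 𝒞.A (monomialOp 𝒞.A i j v) = monomialOp 𝒞.A (i + 1) j v := by
  simp [monomialOp, pow_succ']

/-- `A A^* = r` lets `A` remove a factor `A^*`; thus powers of `A^*` can be handled through `A`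
alone, the only operator that `A_N` is known to imitate. -/
theorem A_monomial_zero_succ (j : ℕ) (v : H) :
    𝒞.A (monomialOp 𝒞.A 0 (j + 1) v) = (𝒞.r : ℂ) • monomialOp 𝒞.A 0 j v := by
  have := congrArg (fun T : H →L[ℂ] H => T (monomialOp 𝒞.A 0 j v)) 𝒞.self_mul_adjoint
  simpa [monomialOp, pow_succ'] using this

end CyclicOperator

/-! ### Eigenvalues of `A_N`, coefficients in the eigenbasis, integrals for `μ_N` -/

namespace Approximation

variable {𝒞 : CyclicOperator H} (𝒜 : Approximation 𝒞)

theorem normSq_lam (N : ℕ) (n : Fin (Module.finrank ℂ (𝒞.HN N))) : ‖𝒜.lam N n‖ ^ 2 = 𝒞.r := by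
  have h := 𝒞.norm_AN_apply (𝒜.U N) (𝒜.u N n)
  rw [𝒜.AN_u, norm_smul, (𝒜.u N).norm_eq_one] at h
  simpa using h

theorem norm_lam (N : ℕ) (n : Fin (Module.finrank ℂ (𝒞.HN N))) : ‖𝒜.lam N n‖ = √𝒞.r := by
  rw [← 𝒜.normSq_lam N n, Real.sqrt_sq (norm_nonneg _)]

theorem mem_intS {z : ℂ} (hz : ‖z‖ < 𝒜.M) : z ∈ 𝒜.intS := by
  have h1 := abs_lt.1 ((Complex.abs_re_le_norm z).trans_lt hz)
  have h2 := abs_lt.1 ((Complex.abs_im_le_norm z).trans_lt hz)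
  exact ⟨h1.1, h1.2, h2.1, h2.2⟩

theorem intS_subset_S : 𝒜.intS ⊆ 𝒜.S := fun _ h => ⟨h.1.le, h.2.1.le, h.2.2.1.le, h.2.2.2.le⟩

theorem lam_mem_S (N : ℕ) (n : Fin (Module.finrank ℂ (𝒞.HN N))) : 𝒜.lam N n ∈ 𝒜.S :=
  𝒜.intS_subset_S (𝒜.mem_intS (by rw [𝒜.norm_lam]; exact 𝒜.sqrt_lt_M))

theorem isCompact_S : IsCompact 𝒜.S := by
  have h : 𝒜.S = Set.Icc (-(𝒜.M : ℝ)) 𝒜.M ×ℂ Set.Icc (-(𝒜.M : ℝ)) 𝒜.M := by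
    ext z; simp [Approximation.S, Complex.mem_reProdIm, and_assoc]
  rw [h]
  exact isCompact_Icc.reProdIm isCompact_Icc

/-- `A_N` is diagonal in an orthonormal basis, so the identity follows by expanding `v`, with no
appeal to the adjoint of `A_N`. -/
theorem inner_u_AN (N : ℕ) (n : Fin (Module.finrank ℂ (𝒞.HN N))) (v : 𝒞.HN N) :
    inner ℂ (𝒜.u N n) (𝒞.AN N (𝒜.U N) v) = 𝒜.lam N n * inner ℂ (𝒜.u N n) v := by
  conv_lhs => rw [← (𝒜.u N).sum_repr v]
  simp only [map_sum, map_smul, 𝒜.AN_u, inner_sum, inner_smul_right,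
    orthonormal_iff_ite.1 (𝒜.u N).orthonormal]
  simp [(𝒜.u N).repr_apply_apply, mul_comm]

theorem inner_u_A {N : ℕ} (n : Fin (Module.finrank ℂ (𝒞.HN N))) {v : H} (hv : v ∈ 𝒞.HNminus N) :
    inner ℂ (𝒜.u N n : H) (𝒞.A v) = 𝒜.lam N n * inner ℂ (𝒜.u N n : H) v := by
  have h := 𝒜.inner_u_AN N n ⟨v, 𝒞.HNminus_le_HN N hv⟩
  rw [Submodule.coe_inner, Submodule.coe_inner, 𝒞.AN_apply_of_mem_HNminus _ _ hv] at h
  exact h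

/-- With `c_j` the coefficient of `(A^*)^j φ`, applying `A` to `(A^*)^(j+1) φ ∈ H_N^-` gives `λ
c_(j+1) = r c_j = λ (conj λ) c_j`, and `λ ≠ 0` because `|λ|^2 = r > 0`. -/
theorem inner_u_monomial_zero {N j : ℕ} (n : Fin (Module.finrank ℂ (𝒞.HN N))) (hj : j ≤ N) :
    inner ℂ (𝒜.u N n : H) (monomialOp 𝒞.A 0 j 𝒞.φ) =
      starRingEnd ℂ (𝒜.lam N n) ^ j * 𝒜.xi N n := by
  induction j with
  | zero => simp [monomialOp, 𝒜.inner_u_φ]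
  | succ j ih =>
    have h := 𝒜.inner_u_A n (𝒞.monomial_mem_HNminus (i := 0) (by omega) hj)
    rw [𝒞.A_monomial_zero_succ, inner_smul_right, ih (by omega)] at h
    have hr : (𝒞.r : ℂ) = 𝒜.lam N n * starRingEnd ℂ (𝒜.lam N n) := by
      rw [Complex.mul_conj, Complex.normSq_eq_norm_sq, 𝒜.normSq_lam]
    have hne : 𝒜.lam N n ≠ 0 := by
      intro h0
      rw [h0, zero_mul] at hr
      exact 𝒞.r_pos.ne' (by exact_mod_cast hr)
    refine mul_left_cancel₀ hne ?_
    rw [← h, hr]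
    ring

/-- Each further factor `A` contributes a `λ`, as `A^i (A^*)^j φ` stays in `H_N^-` while `i < N`. -/
theorem inner_u_monomial {N i j : ℕ} (n : Fin (Module.finrank ℂ (𝒞.HN N))) (hi : i ≤ N)
    (hj : j ≤ N) : inner ℂ (𝒜.u N n : H) (monomialOp 𝒞.A i j 𝒞.φ) =
      𝒜.lam N n ^ i * starRingEnd ℂ (𝒜.lam N n) ^ j * 𝒜.xi N n := by
  induction i with
  | zero => rw [𝒜.inner_u_monomial_zero n hj]; ring
  | succ i ih =>
    rw [← 𝒞.A_monomial, 𝒜.inner_u_A n (𝒞.monomial_mem_HNminus (by omega) hj), ih (by omega)]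
    ring

/-- For large `N` the vector `P(A, A^*) φ` lies in `H_N` and has the coefficients
`P(λ, conj λ) ξ` in the basis of eigenvectors. -/
theorem eventually_polyVec (P : MvPolynomial (Fin 2) ℂ) :
    ∀ᶠ N in atTop, polyVec 𝒞.A 𝒞.φ P ∈ 𝒞.HN N ∧ ∀ n,
      inner ℂ (𝒜.u N n : H) (polyVec 𝒞.A 𝒞.φ P) = polyEval P (𝒜.lam N n) * 𝒜.xi N n := by
  induction P using MvPolynomial.induction_on' with
  | monomial m c =>
    filter_upwards [eventually_ge_atTop (m 0), eventually_ge_atTop (m 1)] with N h0 h1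
    rw [𝒞.polyVec_monomial]
    refine ⟨Submodule.smul_mem _ _ (𝒞.monomial_mem_HN h0 h1), fun n => ?_⟩
    rw [inner_smul_right, 𝒜.inner_u_monomial n h0 h1, polyEval_monomial]
    ring
  | add P Q hP hQ =>
    filter_upwards [hP, hQ] with N h1 h2
    rw [map_add]
    refine ⟨add_mem h1.1 h2.1, fun n => ?_⟩
    rw [inner_add_right, h1.2, h2.2, polyEval_add]
    ring

/-- The integral of `f` for the measure `μ_N`. -/
noncomputable def intN (N : ℕ) (f : ℂ → ℂ) : ℂ := ∑ n, (𝒜.xi N n : ℂ) ^ 2 * f (𝒜.lam N n)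

/-- Parseval for `φ` and `P(A, A^*) φ`. The equality is exact for large `N`, not merely a limit. -/
theorem eventually_intN_polyEval (P : MvPolynomial (Fin 2) ℂ) :
    ∀ᶠ N in atTop, 𝒜.intN N (polyEval P) = inner ℂ 𝒞.φ (polyVec 𝒞.A 𝒞.φ P) := by
  filter_upwards [𝒜.eventually_polyVec P] with N hN
  have h := (𝒜.u N).sum_inner_mul_inner (⟨𝒞.φ, 𝒞.φ_mem_HN N⟩ : 𝒞.HN N) ⟨_, hN.1⟩
  simp only [Submodule.coe_inner, hN.2] at h
  rw [← h, intN]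
  refine Finset.sum_congr rfl fun n _ => ?_
  rw [← inner_conj_symm, 𝒜.inner_u_φ, Complex.conj_ofReal]
  ring

theorem norm_intN_sub_le (N : ℕ) {f g : ℂ → ℂ} {ε : ℝ}
    (h : ∀ n, ‖f (𝒜.lam N n) - g (𝒜.lam N n)‖ ≤ ε) : ‖𝒜.intN N f - 𝒜.intN N g‖ ≤ ε := by
  rw [intN, intN, ← Finset.sum_sub_distrib]
  calc _ ≤ ∑ n, 𝒜.xi N n ^ 2 * ε := by
        refine norm_sum_le_of_le _ fun n _ => ?_
        rw [← mul_sub, norm_mul, norm_pow, Complex.norm_real, Real.norm_eq_abs, sq_abs]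
        exact mul_le_mul_of_nonneg_left (h n) (sq_nonneg _)
    _ = ε := by rw [← Finset.sum_mul, 𝒜.sum_xi_sq, one_mul]

end Approximation

/-! ### The spectral measure of `A` and `φ` -/

/-- The **spectral theorem** for a normal operator and a vector: the functional
`f ↦ ⟨φ, f(A) φ⟩` is the integral for a finite measure on the spectrum. -/
theorem exists_spectralMeasure (A : H →L[ℂ] H) (hA : IsStarNormal A) (φ : H) :
    ∃ ν : Measure (spectrum ℂ A), IsFiniteMeasure ν ∧
      ∀ f : C(spectrum ℂ A, ℂ), ∫ x, f x ∂ν = inner ℂ φ (cfcHom hA f φ) := by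
  let ofRealC (f : C(spectrum ℂ A, ℝ)) : C(spectrum ℂ A, ℂ) := ⟨fun x => (f x : ℂ), by fun_prop⟩
  -- For real `f` the operator `f(A)` is self-adjoint, so the functional is real.
  have hstar (f : C(spectrum ℂ A, ℝ)) : starRingEnd ℂ (inner ℂ φ (cfcHom hA (ofRealC f) φ)) =
      inner ℂ φ (cfcHom hA (ofRealC f) φ) := by
    have h1 : star (ofRealC f) = ofRealC f := by ext x; simp [ofRealC]
    have h2 : star (cfcHom hA (ofRealC f)) = cfcHom hA (ofRealC f) := by rw [← map_star, h1]
    rw [inner_conj_symm, ← ContinuousLinearMap.adjoint_inner_right,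
      ← ContinuousLinearMap.star_eq_adjoint, h2]
  let Λ₀ : CompactlySupportedContinuousMap (spectrum ℂ A) ℝ →ₗ[ℝ] ℝ :=
    { toFun := fun f => (inner ℂ φ (cfcHom hA (ofRealC f.toContinuousMap) φ)).re
      map_add' := fun f g => by
        have : ofRealC (f + g).toContinuousMap =
          ofRealC f.toContinuousMap + ofRealC g.toContinuousMap := by ext x; simp [ofRealC]
        rw [this, map_add, add_apply, inner_add_right, Complex.add_re]
      map_smul' := fun c f => by
        have : ofRealC (c • f).toContinuousMap = (c : ℂ) • ofRealC f.toContinuousMap := by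
          ext x; simp [ofRealC]
        rw [this, map_smul, smul_apply, inner_smul_right,
          Complex.re_ofReal_mul, RingHom.id_apply, smul_eq_mul] }
  let Λ : CompactlySupportedContinuousMap (spectrum ℂ A) ℝ →ₚ[ℝ] ℝ :=
    PositiveLinearMap.mk₀ Λ₀ fun f hf => by
      -- Positivity: with `g = √f` the value is `⟨φ, g(A)^* g(A) φ⟩ = ‖g(A) φ‖^2`.
      let g : C(spectrum ℂ A, ℂ) := ofRealC ⟨fun x => √(f x), by fun_prop⟩
      have h1 : ofRealC f.toContinuousMap = star g * g := by
        ext x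
        simp only [ofRealC, g, ContinuousMap.mul_apply, ContinuousMap.star_apply,
          ContinuousMap.coe_mk]
        rw [← starRingEnd_apply, Complex.conj_ofReal, ← Complex.ofReal_mul,
          Real.mul_self_sqrt (hf x)]
        rfl
      change 0 ≤ (inner ℂ φ (cfcHom hA (ofRealC f.toContinuousMap) φ)).re
      rw [h1, map_mul, map_star, ContinuousLinearMap.star_eq_adjoint,
        mul_apply_eq_comp, ContinuousLinearMap.adjoint_inner_right]
      exact inner_self_nonneg (𝕜 := ℂ)
  let ν : Measure (spectrum ℂ A) := RealRMK.rieszMeasure Λ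
  have hreal (f : C(spectrum ℂ A, ℝ)) :
      ∫ x, ((f x : ℝ) : ℂ) ∂ν = inner ℂ φ (cfcHom hA (ofRealC f) φ) := by
    rw [integral_complex_ofReal]
    have := RealRMK.integral_rieszMeasure Λ ⟨f, HasCompactSupport.of_compactSpace _⟩
    change ∫ x, f x ∂ν = (inner ℂ φ (cfcHom hA (ofRealC f) φ)).re at this
    rw [this]
    exact Complex.conj_eq_iff_re.1 (hstar f)
  refine ⟨ν, inferInstance, fun f => ?_⟩
  let fr : C(spectrum ℂ A, ℝ) := ⟨fun x => (f x).re, by fun_prop⟩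
  let fi : C(spectrum ℂ A, ℝ) := ⟨fun x => (f x).im, by fun_prop⟩
  have hf : f = ofRealC fr + Complex.I • ofRealC fi := by
    ext x
    simp [ofRealC, fr, fi, mul_comm Complex.I, Complex.re_add_im]
  have hint (g : C(spectrum ℂ A, ℂ)) : Integrable g ν :=
    g.continuous.integrable_of_hasCompactSupport (HasCompactSupport.of_compactSpace _)
  rw [hf, map_add, map_smul, add_apply, smul_apply,
    inner_add_right, inner_smul_right, ← hreal, ← hreal, ← integral_const_mul]
  exact integral_add (hint (ofRealC fr)) ((hint (ofRealC fi)).const_mul _)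

namespace CyclicOperator

variable (𝒞 : CyclicOperator H)

theorem isStarNormal : IsStarNormal 𝒞.A :=
  ⟨by
    rw [commute_iff_eq, ContinuousLinearMap.star_eq_adjoint, 𝒞.adjoint_mul_self,
      𝒞.self_mul_adjoint]⟩

theorem polyFun_eq_polyEval (P : MvPolynomial (Fin 2) ℂ) (z : spectrum ℂ 𝒞.A) :
    polyFun 𝒞 P z = polyEval P z := polyFun_apply 𝒞 P z

/-- Links the monomial-wise definition of `P(A, A^*)` to the functional calculus: on monomials both
agree since the calculus is a star homomorphism sending the identity function to `A`. -/
theorem cfcHom_polyFun (P : MvPolynomial (Fin 2) ℂ) :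
    cfcHom 𝒞.isStarNormal (polyFun 𝒞 P) 𝒞.φ = polyVec 𝒞.A 𝒞.φ P := by
  induction P using MvPolynomial.induction_on' with
  | monomial m c =>
    have hid : (⟨Subtype.val, continuous_subtype_val⟩ : C(spectrum ℂ 𝒞.A, ℂ)) =
      (ContinuousMap.id ℂ).restrict (spectrum ℂ 𝒞.A) := rfl
    have h : polyFun 𝒞 (MvPolynomial.monomial m c) =
        c • ((ContinuousMap.id ℂ).restrict (spectrum ℂ 𝒞.A) ^ m 0 *
          star ((ContinuousMap.id ℂ).restrict (spectrum ℂ 𝒞.A)) ^ m 1) := by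
      ext z
      rw [𝒞.polyFun_eq_polyEval, polyEval_monomial]
      simp
    rw [h, 𝒞.polyVec_monomial, map_smul, map_mul, map_pow, map_pow, map_star, cfcHom_id]
    rfl
  | add P Q hP hQ => rw [map_add, map_add, map_add, add_apply, hP, hQ]

theorem norm_le_of_mem_spectrum {z : ℂ} (hz : z ∈ spectrum ℂ 𝒞.A) : ‖z‖ ≤ ‖𝒞.A‖ := by
  have : Nontrivial H := ⟨⟨𝒞.φ, 0, fun h => by simpa [h] using 𝒞.norm_φ⟩⟩
  exact spectrum.norm_le_norm_of_mem hz

end CyclicOperator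

/-! ### Weak convergence of `μ_N` and identification of `μ` -/

namespace Approximation

variable {𝒞 : CyclicOperator H} (𝒜 : Approximation 𝒞)

theorem spectrum_subset_intS : spectrum ℂ 𝒞.A ⊆ 𝒜.intS := fun _ hz =>
  𝒜.mem_intS ((𝒞.norm_le_of_mem_spectrum hz).trans_lt 𝒜.norm_lt_M)

section WeakLimit

variable {ν : Measure (spectrum ℂ 𝒞.A)}
  (hν : ∀ f : C(spectrum ℂ 𝒞.A, ℂ), ∫ x, f x ∂ν = inner ℂ 𝒞.φ (cfcHom 𝒞.isStarNormal f 𝒞.φ))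

include hν in
theorem measureReal_univ_eq_one : ν.real Set.univ = 1 := by
  have h := hν 1
  rw [map_one, one_apply_eq_self, inner_self_eq_norm_sq_to_K, 𝒞.norm_φ] at h
  simpa using h

variable [IsFiniteMeasure ν]

include hν in
/-- A finite measure on the spectrum that represents the functional `f ↦ ⟨φ, f(A) φ⟩` is the
weak limit of the measures `μ_N`. -/
theorem tendsto_intN (f : C(ℂ, ℂ)) :
    Tendsto (fun N => 𝒜.intN N f) atTop (𝓝 (∫ x : spectrum ℂ 𝒞.A, f x ∂ν)) := by
  rw [Metric.tendsto_nhds]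
  intro ε hε
  -- The approximation is needed on all of `S`: it is used at the eigenvalues of `A_N` as well as on
  -- the spectrum.
  obtain ⟨P, hP⟩ := exists_polyEval_near 𝒜.isCompact_S (f.restrict 𝒜.S) (ε := ε / 3) (by positivity)
  have hP' (z : ℂ) (hz : z ∈ 𝒜.S) : ‖f z - polyEval P z‖ ≤ ε / 3 := by
    rw [norm_sub_rev]; exact (hP ⟨z, hz⟩).le
  have hint (g : C(spectrum ℂ 𝒞.A, ℂ)) : Integrable g ν :=
    g.continuous.integrable_of_hasCompactSupport (HasCompactSupport.of_compactSpace _)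
  have h1 : ∫ x : spectrum ℂ 𝒞.A, polyEval P x ∂ν = inner ℂ 𝒞.φ (polyVec 𝒞.A 𝒞.φ P) := by
    rw [← 𝒞.cfcHom_polyFun, ← hν]
    simp only [𝒞.polyFun_eq_polyEval]
  have h2 : ‖∫ x : spectrum ℂ 𝒞.A, f x ∂ν - ∫ x : spectrum ℂ 𝒞.A, polyEval P x ∂ν‖ ≤ ε / 3 := by
    have hPint : Integrable (fun x : spectrum ℂ 𝒞.A => polyEval P x) ν := by
      simpa only [← 𝒞.polyFun_eq_polyEval] using hint (polyFun 𝒞 P)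
    have hfint : Integrable (fun x : spectrum ℂ 𝒞.A => f x) ν :=
      hint (f.restrict (spectrum ℂ 𝒞.A))
    rw [← integral_sub hfint hPint]
    refine (norm_integral_le_of_norm_le_const (C := ε / 3) (Eventually.of_forall fun x => ?_)).trans ?_
    · exact hP' x (𝒜.intS_subset_S (𝒜.spectrum_subset_intS x.2))
    · rw [measureReal_univ_eq_one hν, mul_one]
  filter_upwards [𝒜.eventually_intN_polyEval P] with N hN
  have h3 := 𝒜.norm_intN_sub_le N (f := f) (g := polyEval P) fun n => hP' _ (𝒜.lam_mem_S N n)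
  rw [hN, ← h1] at h3
  rw [dist_eq_norm]
  rw [norm_sub_rev] at h2
  have := norm_sub_le_norm_sub_add_norm_sub (𝒜.intN N f) (∫ x : spectrum ℂ 𝒞.A, polyEval P x ∂ν)
    (∫ x : spectrum ℂ 𝒞.A, f x ∂ν)
  linarith

include hν in
/-- The weak limit of the measures `μ_N` is at most the naive measure on open sets. -/
theorem map_le_muNaive {X : Set ℂ} (hX : IsOpen X) :
    ν.map Subtype.val X ≤ ENNReal.ofReal (𝒜.muNaive X) := by
  rw [hX.measure_eq_iSup_isCompact]
  refine iSup₂_le fun F hFX => iSup_le fun hF => ?_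
  -- A Urysohn function between `F` and `X`: its integral for `μ_N` is at most `μ_N(X)`, its
  -- integral for `ν` at least `ν(F)`.
  obtain ⟨f, hf1, hf0, -, hf01⟩ := exists_continuous_one_zero_of_isCompact hF hX.isClosed_compl
    (Set.disjoint_compl_right_iff_subset.2 hFX)
  let g : C(ℂ, ℂ) := ⟨fun z => (f z : ℂ), by fun_prop⟩
  have h1 := (Complex.continuous_re.tendsto _).comp
    ((𝒜.tendsto_intN hν g).mono_left 𝒜.D_le_atTop)
  have h2 : (∫ x : spectrum ℂ 𝒞.A, g x ∂ν).re = ∫ x : spectrum ℂ 𝒞.A, f x ∂ν := by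
    change (∫ x : spectrum ℂ 𝒞.A, ((f x : ℝ) : ℂ) ∂ν).re = _
    rw [integral_complex_ofReal, Complex.ofReal_re]
  have h3 : ∫ x : spectrum ℂ 𝒞.A, f x ∂ν ≤ 𝒜.muNaive X := by
    rw [← h2]
    refine le_of_tendsto_of_tendsto' h1 (𝒜.tendsto_muN X) fun N => ?_
    simp only [Function.comp, intN, muN, Complex.re_sum]
    refine Finset.sum_le_sum fun n _ => ?_
    have : ((𝒜.xi N n : ℂ) ^ 2 * g (𝒜.lam N n)).re = 𝒜.xi N n ^ 2 * f (𝒜.lam N n) := by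
      change ((𝒜.xi N n : ℂ) ^ 2 * (f (𝒜.lam N n) : ℂ)).re = _
      rw [← Complex.ofReal_pow, ← Complex.ofReal_mul, Complex.ofReal_re]
    rw [this]
    by_cases hz : 𝒜.lam N n ∈ X
    · rw [Set.indicator_of_mem hz]
      exact mul_le_of_le_one_right (sq_nonneg _) (hf01 _).2
    · rw [Set.indicator_of_notMem hz, hf0 hz]
      simp
  refine le_trans ?_ (ENNReal.ofReal_le_ofReal h3)
  have hm : MeasurableSet (Subtype.val ⁻¹' F : Set (spectrum ℂ 𝒞.A)) :=
    measurable_subtype_coe hF.measurableSet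
  rw [Measure.map_apply measurable_subtype_coe hF.measurableSet, ← ofReal_measureReal,
    ← integral_indicator_one hm]
  refine ENNReal.ofReal_le_ofReal (integral_mono_of_nonneg (Eventually.of_forall fun x => ?_) ?_
    (Eventually.of_forall fun x => ?_))
  · exact Set.indicator_nonneg (fun _ _ => zero_le_one) _
  · exact (show Continuous fun x : spectrum ℂ 𝒞.A => f x by fun_prop).integrable_of_hasCompactSupport
      (HasCompactSupport.of_compactSpace _)
  · by_cases hx : (x : ℂ) ∈ F
    · rw [Set.indicator_of_mem (by exact hx)]
      exact (hf1 hx).ge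
    · rw [Set.indicator_of_notMem (by exact hx)]
      exact (hf01 _).1

variable {𝒜}

theorem NiceSet.isOpen_of_mem_SqStar (𝒩 : 𝒜.NiceSet) {X : Set ℂ} (hX : X ∈ 𝒩.SqStar) :
    IsOpen X := by
  obtain ⟨a, ha, b, hb, c, hc, d, hd, rfl⟩ := hX
  have h : {z | z ∈ 𝒜.S ∧ a < z.re ∧ z.re < b ∧ c < z.im ∧ z.im < d} =
      Set.Ioo a b ×ℂ Set.Ioo c d := by
    ext z
    simp only [Set.mem_ofPred_eq, Complex.mem_reProdIm, Set.mem_Ioo, Approximation.S]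
    constructor
    · rintro ⟨-, h1, h2, h3, h4⟩
      exact ⟨⟨h1, h2⟩, h3, h4⟩
    · rintro ⟨⟨h1, h2⟩, h3, h4⟩
      exact ⟨⟨(𝒩.subset ha).1.trans h1.le, h2.le.trans (𝒩.subset hb).2,
        (𝒩.subset hc).1.trans h3.le, h4.le.trans (𝒩.subset hd).2⟩, h1, h2, h3, h4⟩
  rw [h]
  exact isOpen_Ioo.reProdIm isOpen_Ioo

include hν in
/-- The measure `μ`, restricted to the spectrum, represents the functional `f ↦ ⟨φ, f(A) φ⟩`. -/
theorem NiceSet.muSpec_eq (𝒩 : 𝒜.NiceSet) : 𝒩.muSpec = ν := by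
  -- `μ^*` is the largest outer measure bounded by the naive measure on `Sq^*`, and the rectangles
  -- in `Sq^*` are open.
  have hstar : (ν.map Subtype.val).toOuterMeasure ≤ 𝒩.muStar :=
    le_inducedOuterMeasure.2 fun X hX => 𝒜.map_le_muNaive hν (𝒩.isOpen_of_mem_SqStar hX)
  have hintS : MeasurableSet 𝒜.intS :=
    (𝒩.isOpen_of_mem_SqStar 𝒩.intS_mem_SqStar).measurableSet
  have hle : ν.map Subtype.val ≤ 𝒩.mu := by
    refine Measure.le_iff.2 fun s hs => ?_
    rw [NiceSet.mu, Measure.restrict_apply hs, toMeasure_apply _ _ (hs.inter hintS)]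
    refine le_trans ?_ (hstar (s ∩ 𝒜.intS))
    change ν.map Subtype.val s ≤ ν.map Subtype.val (s ∩ 𝒜.intS)
    rw [Measure.map_apply measurable_subtype_coe hs,
      Measure.map_apply measurable_subtype_coe (hs.inter hintS)]
    exact measure_mono fun x hx => ⟨hx, 𝒜.spectrum_subset_intS x.2⟩
  have hone : ν.map Subtype.val Set.univ = 1 := by
    rw [Measure.map_apply measurable_subtype_coe MeasurableSet.univ, Set.preimage_univ,
      ← ofReal_measureReal, measureReal_univ_eq_one hν, ENNReal.ofReal_one]
  -- Domination together with `μ(ℂ) ≤ 1 = ν(σ(A))` forces equality.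
  have heq : ν.map Subtype.val = 𝒩.mu :=
    Measure.eq_of_le_of_measure_univ_eq hle
      (le_antisymm (hle _) (𝒩.mu_univ_le.trans hone.ge))
  rw [NiceSet.muSpec, ← heq]
  exact (MeasurableEmbedding.subtype_coe (spectrum.isClosed 𝒞.A).measurableSet).comap_map ν

end WeakLimit

/-! ### The isometries between `H` and `L_2(σ(A), μ ↾ σ(A))` -/

namespace NiceSet

variable {𝒜} (𝒩 : 𝒜.NiceSet)

theorem integral_muSpec (f : C(spectrum ℂ 𝒞.A, ℂ)) :
    ∫ x, f x ∂𝒩.muSpec = inner ℂ 𝒞.φ (cfcHom 𝒞.isStarNormal f 𝒞.φ) := by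
  obtain ⟨ν, hfin, hν⟩ := exists_spectralMeasure 𝒞.A 𝒞.isStarNormal 𝒞.φ
  rw [𝒩.muSpec_eq hν, hν]

/-- The map `[f] ↦ f(A) φ` preserves the norm. -/
theorem norm_toL2 (f : C(spectrum ℂ 𝒞.A, ℂ)) :
    ‖𝒩.toL2 f‖ = ‖cfcHom 𝒞.isStarNormal f 𝒞.φ‖ := by
  have h1 : inner ℂ (𝒩.toL2 f) (𝒩.toL2 f) =
      inner ℂ (cfcHom 𝒞.isStarNormal f 𝒞.φ) (cfcHom 𝒞.isStarNormal f 𝒞.φ) := by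
    -- Both sides equal the integral of `|f|^2`, by the representation of `⟨φ, (conj f · f)(A) φ⟩`.
    rw [toL2, ContinuousMap.inner_toLp, ← ContinuousLinearMap.adjoint_inner_right,
      ← ContinuousLinearMap.star_eq_adjoint, ← map_star, ← mul_apply_eq_comp, ← map_mul,
      ← 𝒩.integral_muSpec]
    refine integral_congr_ae (Eventually.of_forall fun x => ?_)
    simp [mul_comm]
  rw [inner_self_eq_norm_sq_to_K, inner_self_eq_norm_sq_to_K] at h1
  exact (sq_eq_sq₀ (norm_nonneg _) (norm_nonneg _)).1 (by exact_mod_cast h1)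

theorem norm_toL2_le (f : C(spectrum ℂ 𝒞.A, ℂ)) : ‖𝒩.toL2 f‖ ≤ ‖f‖ := by
  rw [𝒩.norm_toL2]
  refine (ContinuousLinearMap.le_opNorm _ _).trans ?_
  rw [𝒞.norm_φ, mul_one, norm_cfcHom 𝒞.A f 𝒞.isStarNormal]

theorem norm_polyL2 (P : MvPolynomial (Fin 2) ℂ) : ‖𝒩.polyL2 P‖ = ‖polyVec 𝒞.A 𝒞.φ P‖ := by
  rw [← 𝒞.cfcHom_polyFun, ← 𝒩.norm_toL2]
  rfl

theorem denseRange_polyFun (𝒞 : CyclicOperator H) : DenseRange (polyFun 𝒞) := by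
  intro f
  refine Metric.mem_closure_iff.2 fun ε hε => ?_
  obtain ⟨P, hP⟩ := exists_polyEval_near (spectrum.isCompact 𝒞.A) f hε
  refine ⟨_, ⟨P, rfl⟩, ?_⟩
  rw [dist_comm, ContinuousMap.dist_lt_iff hε]
  intro z
  rw [dist_eq_norm, 𝒞.polyFun_eq_polyEval]
  exact hP z

theorem denseRange_polyL2 : DenseRange 𝒩.polyL2 :=
  (ContinuousMap.toLp_denseRange ℂ 𝒩.muSpec ℂ (by simp)).comp (denseRange_polyFun 𝒞)
    𝒩.toL2.continuous

/-- The defining property of the extension is available only after density of the `[f_P]` and the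
norm bound have been checked; both hold here. -/
theorem Gr_polyL2 (P : MvPolynomial (Fin 2) ℂ) : 𝒩.Gr (𝒩.polyL2 P) = polyVec 𝒞.A 𝒞.φ P :=
  LinearMap.extendOfNorm_eq 𝒩.denseRange_polyL2
    ⟨1, fun P => by rw [one_mul, 𝒩.norm_polyL2]⟩ P

theorem GrInv_polyVec (P : MvPolynomial (Fin 2) ℂ) :
    𝒩.GrInv (polyVec 𝒞.A 𝒞.φ P) = 𝒩.polyL2 P :=
  LinearMap.extendOfNorm_eq 𝒞.cyclic ⟨1, fun P => by rw [one_mul, 𝒩.norm_polyL2]⟩ P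

theorem norm_GrInv (x : H) : ‖𝒩.GrInv x‖ = ‖x‖ := by
  refine DenseRange.induction_on (p := fun x => ‖𝒩.GrInv x‖ = ‖x‖) 𝒞.cyclic x
    (isClosed_eq (by fun_prop) (by fun_prop)) fun P => ?_
  rw [𝒩.GrInv_polyVec, 𝒩.norm_polyL2]

theorem tendsto_intN (f : C(ℂ, ℂ)) :
    Tendsto (fun N => 𝒜.intN N f) atTop (𝓝 (∫ x : spectrum ℂ 𝒞.A, f x ∂𝒩.muSpec)) :=
  𝒜.tendsto_intN 𝒩.integral_muSpec f

end NiceSet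

end Approximation

/-! ### The operators `B_N`: coefficients, uniform bound, continuation of the kernel -/

/-- Asymptotic equality suffices, where `ultraClass_congr` asks for equality of terms. It is needed
because `B_N` only approximates `B`. -/
theorem ultraClass_eq_of_tendsto {D : Ultrafilter ℕ} {E : ℕ → Type*}
    [∀ N, NormedAddCommGroup (E N)] [∀ N, InnerProductSpace ℂ (E N)] {v w : ∀ N, E N}
    (hv : v ∈ finiteSeqSubmodule D E) (hw : w ∈ finiteSeqSubmodule D E)
    (h : Tendsto (fun N => ‖v N - w N‖) (D : Filter ℕ) (𝓝 0)) :
    ultraClass v hv = ultraClass w hw := by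
  let v' : FiniteSeq D E := ⟨v, hv⟩
  let w' : FiniteSeq D E := ⟨w, hw⟩
  change (SeparationQuotient.mk v' : MetricUltraproduct D E) = SeparationQuotient.mk w'
  refine SeparationQuotient.mk_eq_mk.2 (Metric.inseparable_iff.2 ?_)
  rw [dist_eq_norm]
  exact tendsto_nhds_unique (tendsto_norm _) h

namespace Approximation

variable {𝒞 : CyclicOperator H} (𝒜 : Approximation 𝒞)

/-- The factor `ξ_N(n)` is pulled out so that, for `v = P(A, A^*) φ`, the remaining sum is an
integral for `μ_N`. -/
theorem repr_kernelOp (K : ℂ × ℂ → ℂ) (N : ℕ) (v : 𝒞.HN N)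
    (n : Fin (Module.finrank ℂ (𝒞.HN N))) :
    (𝒜.u N).repr (𝒜.kernelOp K N v) n = 𝒜.xi N n * ∑ k, (𝒜.xi N k : ℂ) * (𝒜.u N).repr v k *
      K (𝒜.lam N k, 𝒜.lam N n) := by
  have h : 𝒜.kernelOp K N v = ∑ n, ((𝒜.xi N n : ℂ) * ∑ k, (𝒜.xi N k : ℂ) * (𝒜.u N).repr v k *
      K (𝒜.lam N k, 𝒜.lam N n)) • 𝒜.u N n := by
    rw [kernelOp, LinearMap.coe_mk, AddHom.coe_mk]
    refine Finset.sum_congr rfl fun n _ => ?_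
    rw [Finset.mul_sum, Finset.sum_smul]
    refine Finset.sum_congr rfl fun k _ => ?_
    congr 1
    ring
  rw [h, map_sum]
  simp [OrthonormalBasis.repr_self, Pi.single_apply]

/-- The `ξ_N(n)` form a unit vector, so an error uniform in `n` relative to `ξ_N(n)` is an error in
norm. -/
theorem norm_le_of_repr_le {N : ℕ} {v : 𝒞.HN N} {C : ℝ} (hC : 0 ≤ C)
    (h : ∀ n, ‖(𝒜.u N).repr v n‖ ≤ 𝒜.xi N n * C) : ‖v‖ ≤ C := by
  refine le_of_sq_le_sq ?_ hC
  rw [← (𝒜.u N).repr.norm_map v, EuclideanSpace.norm_sq_eq]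
  calc _ ≤ ∑ n, 𝒜.xi N n ^ 2 * C ^ 2 := Finset.sum_le_sum fun n _ => by
        rw [← mul_pow]
        exact pow_le_pow_left₀ (norm_nonneg _) (h n) 2
    _ = C ^ 2 := by rw [← Finset.sum_mul, 𝒜.sum_xi_sq, one_mul]

/-- Cauchy–Schwarz against the unit vector `ξ_N`. -/
theorem sum_xi_mul_norm_repr_le (N : ℕ) (v : 𝒞.HN N) :
    ∑ k, 𝒜.xi N k * ‖(𝒜.u N).repr v k‖ ≤ ‖v‖ := by
  refine le_of_sq_le_sq ?_ (norm_nonneg _)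
  refine (Finset.sum_mul_sq_le_sq_mul_sq _ _ _).trans ?_
  rw [𝒜.sum_xi_sq, one_mul, ← EuclideanSpace.norm_sq_eq, (𝒜.u N).repr.norm_map]

theorem norm_kernelOp_le {K : ℂ × ℂ → ℂ} {C : ℝ} (hK : ∀ p ∈ 𝒜.S ×ˢ 𝒜.S, ‖K p‖ ≤ C) (hC : 0 ≤ C)
    (N : ℕ) (v : 𝒞.HN N) : ‖𝒜.kernelOp K N v‖ ≤ C * ‖v‖ := by
  refine 𝒜.norm_le_of_repr_le (mul_nonneg hC (norm_nonneg _)) fun n => ?_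
  rw [𝒜.repr_kernelOp, norm_mul, Complex.norm_real, Real.norm_of_nonneg (𝒜.xi_nonneg N n)]
  refine mul_le_mul_of_nonneg_left ?_ (𝒜.xi_nonneg N n)
  refine le_trans ?_ (mul_le_mul_of_nonneg_left (𝒜.sum_xi_mul_norm_repr_le N v) hC)
  rw [Finset.mul_sum]
  refine norm_sum_le_of_le _ fun k _ => ?_
  rw [norm_mul, norm_mul, Complex.norm_real, Real.norm_of_nonneg (𝒜.xi_nonneg N k), mul_comm]
  exact mul_le_mul_of_nonneg_right (hK _ ⟨𝒜.lam_mem_S N k, 𝒜.lam_mem_S N n⟩)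
    (mul_nonneg (𝒜.xi_nonneg N k) (norm_nonneg _))

theorem uniformlyBounded_kernelOp {K : ℂ × ℂ → ℂ} (hK : ContinuousOn K (𝒜.S ×ˢ 𝒜.S)) :
    UniformlyBounded (𝒜.kernelOp K) := by
  obtain ⟨C, hC⟩ := (𝒜.isCompact_S.prod 𝒜.isCompact_S).exists_bound_of_continuousOn hK
  obtain ⟨m, hm⟩ := exists_nat_gt (max C 0)
  refine ⟨m, fun N v hv => ?_⟩
  exact (𝒜.norm_kernelOp_le (C := max C 0) (fun p hp => (hC p hp).trans (le_max_left _ _))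
    (le_max_right _ _) N v).trans_lt (mul_lt_mul_of_pos_right hm (norm_pos_iff.2 hv))

/-- Only the values of the kernel at pairs of eigenvalues enter, and these pairs lie in `S^2`. -/
theorem kernelOp_congr {K K' : ℂ × ℂ → ℂ} (h : Set.EqOn K K' (𝒜.S ×ˢ 𝒜.S)) :
    𝒜.kernelOp K = 𝒜.kernelOp K' := by
  ext N v : 2
  rw [kernelOp, kernelOp, LinearMap.coe_mk, LinearMap.coe_mk, AddHom.coe_mk, AddHom.coe_mk]
  refine Finset.sum_congr rfl fun n _ => Finset.sum_congr rfl fun k _ => ?_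
  rw [h ⟨𝒜.lam_mem_S N k, 𝒜.lam_mem_S N n⟩]

/-- A continuous function on `S ^ 2` agrees with a continuous function on `ℂ ^ 2`. -/
theorem exists_extension_of_continuousOn {K : ℂ × ℂ → ℂ} (hK : ContinuousOn K (𝒜.S ×ˢ 𝒜.S)) :
    ∃ κ : C(ℂ × ℂ, ℂ), Set.EqOn K κ (𝒜.S ×ˢ 𝒜.S) := by
  obtain ⟨κ, hκ⟩ := ContinuousMap.exists_restrict_eq
    (𝒜.isCompact_S.prod 𝒜.isCompact_S).isClosed ⟨_, hK.domRestrict⟩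
  exact ⟨κ, fun p hp => (DFunLike.congr_fun hκ ⟨p, hp⟩).symm⟩

/-- Tietze's theorem for the closed subset `σ(A)^2` of `ℂ^2`. -/
theorem exists_isContinuation (K : C(spectrum ℂ 𝒞.A × spectrum ℂ 𝒞.A, ℂ)) :
    ∃ K' : ℂ × ℂ → ℂ, 𝒜.IsContinuation K K' := by
  have he := (spectrum.isClosed (𝕜 := ℂ) 𝒞.A).isClosedEmbedding_subtypeVal
  obtain ⟨κ, hκ⟩ := K.exists_extension (he.prodMap he)
  exact ⟨κ, κ.continuous.continuousOn, fun x y => DFunLike.congr_fun hκ (x, y)⟩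

/-! ### Convergence of `B_N` to `B` -/

namespace NiceSet

variable {𝒜} (𝒩 : 𝒜.NiceSet)

/-- The bound holds for every `μ_N` and passes to the weak limit. -/
theorem norm_integral_sub_le {f g : C(ℂ, ℂ)} {ε : ℝ}
    (h : ∀ x ∈ 𝒜.S, ‖f x - g x‖ ≤ ε) :
    ‖∫ x : spectrum ℂ 𝒞.A, f x ∂𝒩.muSpec - ∫ x : spectrum ℂ 𝒞.A, g x ∂𝒩.muSpec‖ ≤ ε :=
  le_of_tendsto' ((𝒩.tendsto_intN f).sub (𝒩.tendsto_intN g)).norm fun N =>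
    𝒜.norm_intN_sub_le N fun n => h _ (𝒜.lam_mem_S N n)

/-- The convergence of the integrals for `μ_N` of a function that depends continuously on a
parameter is uniform on compact sets of parameters. -/
theorem eventually_norm_intN_sub_le (F : C(ℂ × ℂ, ℂ)) {ε : ℝ} (hε : 0 < ε) :
    ∀ᶠ N in atTop, ∀ y ∈ 𝒜.S,
      ‖𝒜.intN N (fun x => F (x, y)) - ∫ x : spectrum ℂ 𝒞.A, F (x, y) ∂𝒩.muSpec‖ ≤ ε := by
  let f (y : ℂ) : C(ℂ, ℂ) := ⟨fun x => F (x, y), by fun_prop⟩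
  have hu := (𝒜.isCompact_S.prod 𝒜.isCompact_S).uniformContinuousOn_of_continuous
    F.continuous.continuousOn
  obtain ⟨δ, hδ, hF⟩ := Metric.uniformContinuousOn_iff.1 hu (ε / 3) (by positivity)
  -- On a finite `δ`-net of parameters convergence is simultaneous; equicontinuity in `y` costs `ε /
  -- 3` for `μ_N` and again for `μ`.
  obtain ⟨t, htS, htf, ht⟩ := 𝒜.isCompact_S.finite_cover_balls hδ
  have hev : ∀ᶠ N in atTop, ∀ y ∈ t,
      ‖𝒜.intN N (f y) - ∫ x : spectrum ℂ 𝒞.A, f y x ∂𝒩.muSpec‖ < ε / 3 := by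
    refine (eventually_all_finite htf).2 fun y _ => ?_
    have := Metric.tendsto_nhds.1 (𝒩.tendsto_intN (f y)) (ε / 3) (by positivity)
    simpa only [dist_eq_norm] using this
  filter_upwards [hev] with N hN y hy
  obtain ⟨y', hy', hyy'⟩ := Set.mem_iUnion₂.1 (ht hy)
  have hclose (x : ℂ) (hx : x ∈ 𝒜.S) : ‖f y x - f y' x‖ ≤ ε / 3 := by
    rw [← dist_eq_norm]
    refine (hF _ ⟨hx, hy⟩ _ ⟨hx, htS hy'⟩ ?_).le
    rw [Prod.dist_eq, dist_self, max_eq_right dist_nonneg]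
    exact hyy'
  have h1 := 𝒜.norm_intN_sub_le N (f := f y) (g := f y') fun n => hclose _ (𝒜.lam_mem_S N n)
  have h2 := 𝒩.norm_integral_sub_le hclose
  have h3 := hN y' hy'
  change ‖𝒜.intN N (f y) - ∫ x : spectrum ℂ 𝒞.A, f y x ∂𝒩.muSpec‖ ≤ ε
  rw [norm_sub_rev] at h2
  have h4 := norm_sub_le_norm_sub_add_norm_sub (𝒜.intN N (f y)) (𝒜.intN N (f y'))
    (∫ x : spectrum ℂ 𝒞.A, f y x ∂𝒩.muSpec)
  have h5 := norm_sub_le_norm_sub_add_norm_sub (𝒜.intN N (f y'))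
    (∫ x : spectrum ℂ 𝒞.A, f y' x ∂𝒩.muSpec) (∫ x : spectrum ℂ 𝒞.A, f y x ∂𝒩.muSpec)
  linarith

/-- On the vectors `P(A, A^*) φ` the operators `B_N` converge to `B`. -/
theorem tendsto_kernelOp {B : H →L[ℂ] H} {K : C(spectrum ℂ 𝒞.A × spectrum ℂ 𝒞.A, ℂ)}
    (hK : 𝒩.HasKernel B K) (κ : C(ℂ × ℂ, ℂ)) (hκ : 𝒜.IsContinuation K κ)
    (P : MvPolynomial (Fin 2) ℂ) :
    Tendsto (fun N => ‖𝒜.kernelOp κ N ((𝒞.HN N).orthogonalProjectionOnto (polyVec 𝒞.A 𝒞.φ P)) -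
      (𝒞.HN N).orthogonalProjectionOnto (B (polyVec 𝒞.A 𝒞.φ P))‖) atTop (𝓝 0) := by
  let F : C(ℂ × ℂ, ℂ) := ⟨fun p => κ p * polyEval P p.1,
    κ.continuous.mul ((continuous_polyEval P).comp continuous_fst)⟩
  have hcont : Continuous fun y => ∫ x : spectrum ℂ 𝒞.A, F (x, y) ∂𝒩.muSpec := by
    have := continuous_parametric_integral_of_continuous (μ := 𝒩.muSpec)
      (f := fun (y : ℂ) (x : spectrum ℂ 𝒞.A) => F (x, y)) (by fun_prop) isCompact_univ
    simpa only [Measure.restrict_univ] using this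
  -- `h` continues the representative `g` of `B_D(f_P)` off the spectrum, so that it can be
  -- evaluated at the eigenvalues of `A_N`.
  let h : C(ℂ, ℂ) := ⟨fun y => ∫ x : spectrum ℂ 𝒞.A, F (x, y) ∂𝒩.muSpec, hcont⟩
  obtain ⟨g, hg, hgK⟩ := hK P
  have hgh (y : spectrum ℂ 𝒞.A) : g y = h y := by
    rw [hgK]
    refine integral_congr_ae (Eventually.of_forall fun x => ?_)
    simp only [F, ContinuousMap.coe_mk, hκ.2, 𝒞.polyFun_eq_polyEval]
  have hB : 𝒩.GrInv (B (polyVec 𝒞.A 𝒞.φ P)) = 𝒩.toL2 g := by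
    rw [hg, ← 𝒩.Gr_polyL2]
    rfl
  rw [Metric.tendsto_nhds]
  intro ε hε
  -- Three errors of `ε / 4` occur: `μ_N` against `μ` in the integral, `h` against `f_Q` at the
  -- eigenvalues, and `Q(A, A^*) φ` against `B P(A, A^*) φ`. Their sum stays strictly below `ε`.
  obtain ⟨Q, hQ⟩ := exists_polyEval_near 𝒜.isCompact_S (h.restrict 𝒜.S) (ε := ε / 4)
    (by positivity)
  have hBQ : ‖polyVec 𝒞.A 𝒞.φ Q - B (polyVec 𝒞.A 𝒞.φ P)‖ ≤ ε / 4 := by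
    have h1 : 𝒩.polyL2 Q - 𝒩.toL2 g = 𝒩.toL2 (polyFun 𝒞 Q - g) := (map_sub 𝒩.toL2 _ _).symm
    -- The distance is measured in `L_2`, where it is at most the supremum of `|f_Q - h|` over the
    -- spectrum.
    rw [← 𝒩.norm_GrInv, map_sub, 𝒩.GrInv_polyVec, hB, h1]
    refine (𝒩.norm_toL2_le _).trans ((ContinuousMap.norm_le _ (by positivity)).2 fun y => ?_)
    rw [ContinuousMap.sub_apply, hgh, 𝒞.polyFun_eq_polyEval]
    exact (hQ ⟨y, 𝒜.intS_subset_S (𝒜.spectrum_subset_intS y.2)⟩).le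
  filter_upwards [𝒜.eventually_polyVec P, 𝒜.eventually_polyVec Q,
    𝒩.eventually_norm_intN_sub_le F (ε := ε / 4) (by positivity)] with N hNP hNQ hN
  have eP : (𝒞.HN N).orthogonalProjectionOnto (polyVec 𝒞.A 𝒞.φ P) = ⟨_, hNP.1⟩ :=
    Submodule.orthogonalProjectionOnto_mem_subspace_eq_self ⟨_, hNP.1⟩
  have eQ : (𝒞.HN N).orthogonalProjectionOnto (polyVec 𝒞.A 𝒞.φ Q) = ⟨_, hNQ.1⟩ :=
    Submodule.orthogonalProjectionOnto_mem_subspace_eq_self ⟨_, hNQ.1⟩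
  have hclose : ‖𝒜.kernelOp κ N ⟨_, hNP.1⟩ - ⟨_, hNQ.1⟩‖ ≤ ε / 4 + ε / 4 := by
    refine 𝒜.norm_le_of_repr_le (by positivity) fun n => ?_
    have rP (k) : (𝒜.u N).repr ⟨_, hNP.1⟩ k = polyEval P (𝒜.lam N k) * 𝒜.xi N k := by
      rw [OrthonormalBasis.repr_apply_apply]
      exact hNP.2 k
    have rQ : (𝒜.u N).repr ⟨_, hNQ.1⟩ n = polyEval Q (𝒜.lam N n) * 𝒜.xi N n := by
      rw [OrthonormalBasis.repr_apply_apply]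
      exact hNQ.2 n
    have e : (𝒜.u N).repr (𝒜.kernelOp κ N ⟨_, hNP.1⟩ - ⟨_, hNQ.1⟩) n = 𝒜.xi N n *
        (𝒜.intN N (fun x => F (x, 𝒜.lam N n)) - polyEval Q (𝒜.lam N n)) := by
      rw [map_sub, PiLp.sub_apply, 𝒜.repr_kernelOp, rQ, mul_sub, mul_comm (polyEval Q _)]
      congr 2
      refine Finset.sum_congr rfl fun k _ => ?_
      rw [rP]
      simp only [F, ContinuousMap.coe_mk]
      ring
    rw [e, norm_mul, Complex.norm_real, Real.norm_of_nonneg (𝒜.xi_nonneg N n)]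
    refine mul_le_mul_of_nonneg_left ?_ (𝒜.xi_nonneg N n)
    refine (norm_sub_le_norm_sub_add_norm_sub _ (h (𝒜.lam N n)) _).trans
      (add_le_add (hN _ (𝒜.lam_mem_S N n)) ?_)
    rw [norm_sub_rev]
    exact (hQ ⟨_, 𝒜.lam_mem_S N n⟩).le
  have hproj : ‖(⟨_, hNQ.1⟩ : 𝒞.HN N) -
      (𝒞.HN N).orthogonalProjectionOnto (B (polyVec 𝒞.A 𝒞.φ P))‖ ≤ ε / 4 := by
    rw [← eQ, ← map_sub]
    exact (Submodule.norm_orthogonalProjectionOnto_apply_le _ _).trans hBQ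
  rw [dist_zero_right, norm_norm, eP]
  refine (norm_sub_le_norm_sub_add_norm_sub _ (⟨_, hNQ.1⟩ : 𝒞.HN N) _).trans_lt ?_
  linarith

end NiceSet

end Approximation

end FiniteApproximation

/-! ### The theorem: from the dense set to all of `H` -/

theorem lemma5p1 {H : Type*} [NormedAddCommGroup H] [InnerProductSpace ℂ H] [CompleteSpace H]
    [TopologicalSpace.SeparableSpace H]
    (𝒞 : FiniteApproximation.CyclicOperator H)
    (𝒜 : FiniteApproximation.Approximation 𝒞)
    (𝒩 : 𝒜.NiceSet)
    (B : H →L[ℂ] H)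
    (K : C(spectrum ℂ 𝒞.A × spectrum ℂ 𝒞.A, ℂ))
    (hK : 𝒩.HasKernel B K) :
    (∃ K' : ℂ × ℂ → ℂ, 𝒜.IsContinuation K K') ∧
      ∀ K' : ℂ × ℂ → ℂ, 𝒜.IsContinuation K K' →
        ∃ hT : FiniteApproximation.UniformlyBounded (𝒜.kernelOp K'),
          𝒜.RestrictsTo (𝒜.kernelOp K') hT B := by
  refine ⟨𝒜.exists_isContinuation K, fun K' hK' => ?_⟩
  obtain ⟨κ, hκ⟩ := 𝒜.exists_extension_of_continuousOn hK'.1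
  have hS (x : spectrum ℂ 𝒞.A) : (x : ℂ) ∈ 𝒜.S :=
    𝒜.intS_subset_S (𝒜.spectrum_subset_intS x.2)
  have hκ' : 𝒜.IsContinuation K κ := ⟨κ.continuous.continuousOn, fun x y => by
    rw [← hκ ⟨hS x, hS y⟩, hK'.2]⟩
  refine ⟨𝒜.uniformlyBounded_kernelOp hK'.1, ?_⟩
  -- The proof of boundedness is made arbitrary so that `K'` can be replaced by the globally
  -- continuous `κ` in the operators themselves.
  generalize 𝒜.uniformlyBounded_kernelOp hK'.1 = hT
  revert hT
  rw [𝒜.kernelOp_congr hκ]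
  intro hT x
  obtain ⟨ψ, rfl⟩ := 𝒜.GmEquiv.surjective x
  rw [LinearIsometryEquiv.symm_apply_apply, 𝒜.coe_GmEquiv]
  -- Both sides are continuous in `ψ`, so the vectors `P(A, A^*) φ` suffice.
  refine DenseRange.induction_on (p := fun ψ => FiniteApproximation.ultraOperator 𝒜.D
    (𝒜.kernelOp κ) hT (𝒜.Gm ψ) = 𝒜.Gm (B ψ)) 𝒞.cyclic ψ
    (isClosed_eq (by fun_prop) (by fun_prop)) fun P => ?_
  exact FiniteApproximation.ultraClass_eq_of_tendsto _ _
    ((𝒩.tendsto_kernelOp hK κ hκ' P).mono_left 𝒜.D_le_atTop)
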